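/- Let $c_0,c_1,c_2,\dots$ be independent formal (infinitesimal) variables, and put $P(X)=\sum_{a\ge 0}c_aX^a$ and $A(v,y)=v^{-1}P\bigl(v(1+y)^2\bigr)=\sum_{a\ge0}c_a v^{a-1}(1+y)^{2a}$. Define the formal power series $T(v,y)\in\mathbb{Q}[v^{\pm1},y^{\pm1}][[c_0,c_1,\dots]]$ by $$T(v,y)=y+\sum_{r=1}^{\infty}\frac1{r!}\Bigl(\frac1y\frac{d}{dy}\Bigr)^{r-1}\Bigl(\frac{1+y}{y}\,A(v,y)^r\Bigr).$$ Its odd part $\frac{T(v,y)-T(v,-y)}{2}$ with respect to $y$ has constant term $y$ as a power series in the $c_a$, and is therefore invertible in $\mathbb{Q}[v^{\pm1},y^{\pm1}][[c_0,c_1,\dots]]$. For every positive even integer $N$, the coefficient of $v^{N-1}y^{-2}$ in its $(-N)$-th power, which is a power series in $c_0,c_1,\dots$ over $\mathbb{Q}$, is $$\bigl[v^{N-1}y^{-2}\bigr]\Bigl(\frac{T(v,y)-T(v,-y)}{2}\Bigr)^{-N}=-\frac{(2N+1)!}{(N-1)!\,(N+1)!}\,c_N .$$ In particular, this coefficient is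 linear in the $c_a$: all its terms of total degree different from $1$ vanish. -/

import Mathlib

open scoped LaurentPolynomial Nat

noncomputable section

namespace CuriousIdentity

/-- The ring `ℚ[v^{±1}, y^{±1}]`, as Laurent polynomials in `y` over Laurent polynomials in `v`. -/
abbrev R : Type := LaurentPolynomial (LaurentPolynomial ℚ)

/-- The ring `ℚ[v^{±1}, y^{±1}][[c₀, c₁, …]]` of formal power series in the infinitely many
variables `c_a = MvPowerSeries.X a`. -/
abbrev S : Type := MvPowerSeries ℕ R

/-- The monomial `v ^ n`. -/
def v (n : ℤ) : R := LaurentPolynomial.C (LaurentPolynomial.T n)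

/-- The monomial `y ^ n`. -/
def y (n : ℤ) : R := LaurentPolynomial.T n

/-- The element `y` as a unit. -/
def yUnit : Rˣ where
  val := y 1
  inv := y (-1)
  val_inv := by rw [y, y, ← LaurentPolynomial.T_add]; rfl
  inv_val := by rw [y, y, ← LaurentPolynomial.T_add]; rfl

/-- The derivative `d/dy`. -/
def ddy (f : R) : R :=
  f.coeff.sum fun n r => AddMonoidAlgebra.single (n - 1) (n • r)

/-- The operator `(1/y) d/dy`, acting on every coefficient of a power series in the `c_a`. -/
def D (f : S) : S := fun m => y (-1) * ddy (MvPowerSeries.coeff m f)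

/-- The substitution `y ↦ -y`. -/
def negY : R →+* R := LaurentPolynomial.eval₂ LaurentPolynomial.C (-yUnit)

/-- The sum of a family of power series, coefficient by coefficient. It is the sum in the usual
sense for families such that every monomial occurs in only finitely many members. -/
def formalSum (F : ℕ → S) : S := fun m => ∑ᶠ i, MvPowerSeries.coeff m (F i)

/-- The `a`-th term `c_a X ^ a` of `P(X)` at `X = v (1 + y) ^ 2`. -/
def termP (a : ℕ) : S :=
  MvPowerSeries.X a * MvPowerSeries.C ((v 1 * (1 + y 1) ^ 2) ^ a)

/-- `A(v, y) = v⁻¹ P(v (1 + y) ^ 2)`. -/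
def A : S := MvPowerSeries.C (v (-1)) * formalSum termP

/-- The term of index `r + 1` of the sum defining `T(v, y)`. -/
def termT (r : ℕ) : S :=
  (1 / ((r + 1)! : ℚ)) • D^[r] (MvPowerSeries.C ((1 + y 1) * y (-1)) * A ^ (r + 1))

/-- `T(v, y) = y + ∑_{r ≥ 1} (1/r!) ((1/y) d/dy)^{r-1} (((1 + y)/y) A(v, y)^r)`. -/
def T : S := MvPowerSeries.C (y 1) + formalSum termT

/-- `(T(v, y) - T(v, -y)) / 2`. -/
def oddT : S := (1 / 2 : ℚ) • (T - MvPowerSeries.map negY T)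

/-- The coefficient of `v ^ i y ^ j` of a power series in the `c_a` over `ℚ[v^{±1}, y^{±1}]`, a
power series in the `c_a` over `ℚ`. -/
def coeffVY (i j : ℤ) (f : S) : MvPowerSeries ℕ ℚ :=
  fun m => ((MvPowerSeries.coeff m f).coeff j).coeff i

/-! The families summed above are locally finite, and `oddT` is invertible. -/

theorem coeff_termP (a : ℕ) (m : ℕ →₀ ℕ) (h : m ≠ Finsupp.single a 1) :
    MvPowerSeries.coeff m (termP a) = 0 := by
  classical
  rw [termP, MvPowerSeries.coeff_mul_C, MvPowerSeries.coeff_X, if_neg h, zero_mul]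

theorem termP_finite (m : ℕ →₀ ℕ) :
    (Function.support fun a => MvPowerSeries.coeff m (termP a)).Finite := by
  refine m.support.finite_toSet.subset fun a ha => ?_
  by_contra hm
  refine ha (coeff_termP a m ?_)
  rintro rfl
  simp at hm

theorem ddy_zero : ddy 0 = 0 := by simp [ddy]

theorem coeff_D (f : S) (m : ℕ →₀ ℕ) :
    MvPowerSeries.coeff m (D f) = y (-1) * ddy (MvPowerSeries.coeff m f) := rfl

theorem coeff_qsmul (q : ℚ) (f : S) (m : ℕ →₀ ℕ) :
    MvPowerSeries.coeff m (q • f) = q • MvPowerSeries.coeff m f := rfl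

theorem coeff_iterate_D (r : ℕ) (f : S) (m : ℕ →₀ ℕ) (h : MvPowerSeries.coeff m f = 0) :
    MvPowerSeries.coeff m (D^[r] f) = 0 := by
  induction r with
  | zero => exact h
  | succ r ih => rw [Function.iterate_succ_apply', coeff_D, ih, ddy_zero, mul_zero]

theorem constantCoeff_A : MvPowerSeries.constantCoeff A = 0 := by
  rw [A, map_mul]
  have : MvPowerSeries.constantCoeff (formalSum termP) = 0 := by
    rw [← MvPowerSeries.coeff_zero_eq_constantCoeff_apply]
    refine (finsum_congr fun a => coeff_termP a 0 ?_).trans finsum_zero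
    exact (Finsupp.single_ne_zero.2 one_ne_zero).symm
  rw [this, mul_zero]

theorem coeff_termT (r : ℕ) (m : ℕ →₀ ℕ) (h : m.degree < r + 1) :
    MvPowerSeries.coeff m (termT r) = 0 := by
  have hA : MvPowerSeries.coeff m (A ^ (r + 1)) = 0 := by
    apply MvPowerSeries.coeff_of_lt_order
    have h1 : (1 : ℕ∞) ≤ A.order := by
      rw [MvPowerSeries.one_le_order_iff_constCoeff_eq_zero]
      exact constantCoeff_A
    calc (m.degree : ℕ∞) < ((r + 1 : ℕ) : ℕ∞) := by exact_mod_cast h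
      _ = (r + 1) • (1 : ℕ∞) := by simp
      _ ≤ (r + 1) • A.order := nsmul_le_nsmul_right h1 _
      _ ≤ (A ^ (r + 1)).order := MvPowerSeries.le_order_pow _
  rw [termT, coeff_qsmul, coeff_iterate_D, smul_zero]
  rw [MvPowerSeries.coeff_C_mul, hA, mul_zero]

theorem termT_finite (m : ℕ →₀ ℕ) :
    (Function.support fun r => MvPowerSeries.coeff m (termT r)).Finite := by
  refine (Set.finite_lt_nat m.degree).subset fun r hr => ?_
  by_contra hm
  exact hr (coeff_termT r m (by simp at hm; omega))

theorem negY_y : negY (y 1) = - y 1 := by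
  simp [negY, y, yUnit]

theorem constantCoeff_T : MvPowerSeries.constantCoeff T = y 1 := by
  rw [T, map_add, MvPowerSeries.constantCoeff_C]
  have : MvPowerSeries.constantCoeff (formalSum termT) = 0 := by
    rw [← MvPowerSeries.coeff_zero_eq_constantCoeff_apply]
    exact (finsum_congr fun r => coeff_termT r 0 (by simp)).trans finsum_zero
  rw [this, add_zero]

theorem constantCoeff_oddT : MvPowerSeries.constantCoeff oddT = yUnit := by
  rw [← MvPowerSeries.coeff_zero_eq_constantCoeff_apply, oddT, coeff_qsmul, map_sub,
    MvPowerSeries.coeff_map, MvPowerSeries.coeff_zero_eq_constantCoeff_apply, constantCoeff_T,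
    negY_y, sub_neg_eq_add, ← two_smul ℚ, smul_smul]
  norm_num [yUnit]

/-- `(T(v, y) - T(v, -y)) / 2` as a unit of `ℚ[v^{±1}, y^{±1}][[c₀, c₁, …]]`, so that it has
negative powers. -/
def oddTUnit : Sˣ where
  val := oddT
  inv := MvPowerSeries.invOfUnit oddT yUnit
  val_inv := MvPowerSeries.mul_invOfUnit _ _ constantCoeff_oddT
  inv_val := MvPowerSeries.invOfUnit_mul _ _ constantCoeff_oddT

end CuriousIdentity

end

noncomputable section

namespace CuriousIdentity

/-! Let `t = y + O(c)` solve `t² = y² + 2a` with `a = A(v, t)`. Lagrange inversion, applied to `t +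
t²/2`, sums the series: `T = t + a` (`T_eq`). The map `y ↦ -y` preserves the equation and gives the
second branch `t' = -y + O(c)`, with `a' = A(v, t')`.

Write `1 + t = w(1 + g)` and `1 + t' = w(1 - g)`. Then `oddT = w² g` (`exists_parameters`), so for
`k = v w²` one has `v · oddT = k g`. The required coefficient is therefore the constant term of `v
y² (k g)^(-N)`, and it can be computed in the coordinates `(k, g)`. A residue-type formula
(`CT_sub_mul_jac`) says that constant terms survive this change of variables, once the logarithmic
Jacobian is inserted.

It remains to express `v y²` through `k` and `g`. Put `U = k(1 + g)²`, `V = k(1 - g)²` and `Q = X -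
2P(X)`. The equations of the two branches say that `(Q(U) - Q(V))/(U - V) = 1/w` and `Q(U) + Q(V) =
v(4w - 2 + 2y²)`. Poisson brackets of these quantities produce `4 v y²` as `density` times the
Jacobian (`sub_density`).

The density has two parts at most linear in the `c_a`, and one nonlinear part, a bracket of `log
quot` and `total`. The exchange `(v, y) ↦ (v y², 1/y)` fixes `v(1 ± y)²` and `v y` but reverses
orientation, so the nonlinear part contributes nothing (`CT_bracket_quot_total`). The linear parts
are read off from the binomial expansion of `(1 ± y)^(2a)`. -/

/-! ### Monomials and diagonal derivations of the Laurent ring -/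

/-- The monomial `q v ^ i y ^ j`. -/
def mono (q : ℚ) (i j : ℤ) : R :=
  LaurentPolynomial.C (LaurentPolynomial.C q * LaurentPolynomial.T i) * LaurentPolynomial.T j

theorem mono_eq_single (q : ℚ) (i j : ℤ) :
    mono q i j = AddMonoidAlgebra.single j (AddMonoidAlgebra.single i q) := by
  rw [mono, ← LaurentPolynomial.single_eq_C_mul_T, ← LaurentPolynomial.single_eq_C_mul_T]

theorem R_induction {p : R → Prop} (f : R) (add : ∀ f g, p f → p g → p (f + g))
    (hmono : ∀ q i j, p (mono q i j)) : p f := by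
  refine LaurentPolynomial.induction_on' f add fun j a => ?_
  refine LaurentPolynomial.induction_on' a (fun f g hf hg => ?_) fun i q => hmono q i j
  rw [map_add, add_mul]
  exact add _ _ hf hg

theorem mono_mul (q q' : ℚ) (i i' j j' : ℤ) :
    mono q i j * mono q' i' j' = mono (q * q') (i + i') (j + j') := by
  simp only [mono, map_mul, LaurentPolynomial.T_add]
  ring

theorem mono_add (q q' : ℚ) (i j : ℤ) : mono q i j + mono q' i j = mono (q + q') i j := by
  simp only [mono, map_add, add_mul]

theorem smul_mono (c q : ℚ) (i j : ℤ) : c • mono q i j = mono (c * q) i j := by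
  simp only [mono_eq_single, AddMonoidAlgebra.smul_single, smul_eq_mul]

theorem coeff_mono (q : ℚ) (i j i' j' : ℤ) :
    ((mono q i j).coeff j').coeff i' = if i = i' ∧ j = j' then q else 0 := by
  rw [mono_eq_single]
  rw [AddMonoidAlgebra.coeff_single, Finsupp.single_apply]
  by_cases h : j = j'
  · rw [if_pos h, AddMonoidAlgebra.coeff_single, Finsupp.single_apply]
    simp [h]
  · simp [h]

theorem R_ext {f g : R} (h : ∀ i j, (f.coeff j).coeff i = (g.coeff j).coeff i) : f = g :=
  LaurentPolynomial.ext fun j => LaurentPolynomial.ext fun i => h i j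

theorem v_eq (i : ℤ) : v i = mono 1 i 0 := by simp [v, mono]

theorem y_eq (j : ℤ) : y j = mono 1 0 j := by simp [y, mono]

theorem one_eq_mono : (1 : R) = mono 1 0 0 := by simp [mono]

theorem coeff_coeff_mul_mono (f : R) (q : ℚ) (i j i' j' : ℤ) :
    ((f * mono q i j).coeff j').coeff i' = (f.coeff (j' - j)).coeff (i' - i) * q := by
  induction f using R_induction with
  | add f g hf hg => rw [add_mul]; simp [hf, hg, add_mul]
  | hmono p a b =>
    simp only [mono_mul, coeff_mono, eq_sub_iff_add_eq]
    split_ifs <;> simp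

theorem eq_of_linear {M : Type*} [Add M] {f g : R → M} (hf : ∀ a b, f (a + b) = f a + f b)
    (hg : ∀ a b, g (a + b) = g a + g b) (h : ∀ q i j, f (mono q i j) = g (mono q i j)) (a : R) :
    f a = g a := by
  induction a using R_induction with
  | add a b ha hb => rw [hf, hg, ha, hb]
  | hmono q i j => exact h q i j

/-- A `ℚ`-linear operator with eigenvectors the monomials, and eigenvalue additive in the exponent,
is a derivation. -/
def derivationOfEigen (L : R →ₗ[ℚ] R) (a b : ℤ)
    (h : ∀ q i j, L (mono q i j) = mono ((a * i + b * j : ℤ) * q) i j) : Derivation ℚ R R :=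
  Derivation.mk' L fun f g => by
    induction f using R_induction with
    | add f f' hf hf' => rw [add_mul, map_add, hf, hf', map_add]; simp only [smul_eq_mul]; ring
    | hmono q i j =>
      induction g using R_induction with
      | add g g' hg hg' => rw [mul_add, map_add, hg, hg', map_add]; simp only [smul_eq_mul]; ring
      | hmono q' i' j' =>
        simp only [smul_eq_mul, mono_mul, h]
        rw [add_comm i' i, add_comm j' j, mono_add]
        congr 1
        push_cast
        ring

/-- The linear operator multiplying `v ^ i y ^ j` by `a i + b j`. -/
def eigenOp (a b : ℤ) : R →ₗ[ℚ] R where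
  toFun f := .ofCoeff <| Finsupp.onFinset f.coeff.support
    (fun j => .ofCoeff <| Finsupp.onFinset (f.coeff j).coeff.support
      (fun i => ((a * i + b * j : ℤ) : ℚ) * (f.coeff j).coeff i) fun i hi => by
        rw [Finsupp.mem_support_iff]; exact right_ne_zero_of_mul hi) fun j hj => by
      rw [Finsupp.mem_support_iff]
      rintro h
      refine hj (LaurentPolynomial.ext fun i => ?_)
      simp [h]
  map_add' f g := R_ext fun i j => by simp [mul_add]
  map_smul' c f := R_ext fun i j => by simp [mul_left_comm]

theorem coeff_eigenOp (a b : ℤ) (f : R) (i j : ℤ) :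
    ((eigenOp a b f).coeff j).coeff i = ((a * i + b * j : ℤ) : ℚ) * (f.coeff j).coeff i := rfl

theorem eigenOp_mono (a b : ℤ) (q : ℚ) (i j : ℤ) :
    eigenOp a b (mono q i j) = mono ((a * i + b * j : ℤ) * q) i j := by
  refine R_ext fun i' j' => ?_
  rw [coeff_eigenOp, coeff_mono, coeff_mono]
  split_ifs with h
  · rw [h.1, h.2]
  · simp

/-- The derivation multiplying `v ^ i y ^ j` by `a i + b j`. -/
def eigenDer (a b : ℤ) : Derivation ℚ R R := derivationOfEigen (eigenOp a b) a b (eigenOp_mono a b)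

theorem coeff_eigenDer (a b : ℤ) (f : R) (i j : ℤ) :
    ((eigenDer a b f).coeff j).coeff i = ((a * i + b * j : ℤ) : ℚ) * (f.coeff j).coeff i := rfl

theorem eigenDer_mono (a b : ℤ) (q : ℚ) (i j : ℤ) :
    eigenDer a b (mono q i j) = mono ((a * i + b * j : ℤ) * q) i j := eigenOp_mono a b q i j

theorem ddy_add (f g : R) : ddy (f + g) = ddy f + ddy g := by
  rw [ddy, AddMonoidAlgebra.coeff_add, Finsupp.sum_add_index']
  · rfl
  · simp
  · simp

/-- Trades `(1/y) d/dy` for `y⁻² · y d/dy`: the logarithmic derivation is diagonal on monomials, and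
all later calculus is done with it. -/
theorem y_mul_ddy (f : R) : y (-1) * ddy f = y (-2) * eigenDer 0 1 f := by
  refine eq_of_linear (f := fun f => y (-1) * ddy f) (g := fun f => y (-2) * eigenDer 0 1 f)
    (fun a b => ?_) (fun a b => ?_) (fun q i j => ?_) f
  · simp only [ddy_add, mul_add]
  · simp only [map_add, mul_add]
  · simp only [eigenDer_mono]
    have : ddy (mono q i j) = mono (j * q) i (j - 1) := by
      rw [ddy, mono_eq_single, AddMonoidAlgebra.coeff_single, Finsupp.sum_single_index (by simp),
        mono_eq_single, AddMonoidAlgebra.smul_single, zsmul_eq_mul]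
    rw [this, y_eq, y_eq, mono_mul, mono_mul]
    congr 1
    · simp
    · ring

/-! ### Derivations on power series -/

/-- A derivation of the coefficient ring acts on power series coefficientwise. -/
def mapDer (d : Derivation ℚ R R) : Derivation ℚ S S :=
  Derivation.mk'
    { toFun := fun f m => d (MvPowerSeries.coeff m f)
      map_add' := fun f g => by
        ext1 m
        exact (congrArg d (map_add _ f g)).trans (map_add d _ _)
      map_smul' := fun c f => by
        ext1 m
        exact (congrArg d (coeff_qsmul c f m)).trans (d.map_smul c _) }
    fun f g => by
      classical
      ext1 m
      change d (MvPowerSeries.coeff m (f * g)) = _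
      rw [MvPowerSeries.coeff_mul, map_sum, smul_eq_mul, smul_eq_mul, mul_comm g, map_add,
        MvPowerSeries.coeff_mul, MvPowerSeries.coeff_mul, ← Finset.sum_add_distrib]
      refine Finset.sum_congr rfl fun p _ => ?_
      rw [d.leibniz, smul_eq_mul, smul_eq_mul, mul_comm (MvPowerSeries.coeff p.2 g)]
      rfl

theorem coeff_mapDer (d : Derivation ℚ R R) (f : S) (m : ℕ →₀ ℕ) :
    MvPowerSeries.coeff m (mapDer d f) = d (MvPowerSeries.coeff m f) := rfl

theorem mapDer_C (d : Derivation ℚ R R) (r : R) :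
    mapDer d (MvPowerSeries.C r) = MvPowerSeries.C (d r) := by
  classical
  ext1 m
  rw [coeff_mapDer, MvPowerSeries.coeff_C, MvPowerSeries.coeff_C]
  split_ifs
  · rfl
  · exact map_zero d

/-- The derivation `v d/dv`. -/
def thetaV : Derivation ℚ S S := mapDer (eigenDer 1 0)

/-- The derivation `y d/dy`. -/
def thetaY : Derivation ℚ S S := mapDer (eigenDer 0 1)

/-- The Euler derivation, which multiplies a monomial in the `c_a` by its degree. -/
def euler : Derivation ℚ S S :=
  Derivation.mk'
    { toFun := fun f m => (m.degree : ℚ) • MvPowerSeries.coeff m f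
      map_add' := fun f g => by
        ext1 m
        exact smul_add _ (MvPowerSeries.coeff m f) (MvPowerSeries.coeff m g)
      map_smul' := fun c f => by
        ext1 m
        exact smul_comm _ c (MvPowerSeries.coeff m f) }
    fun f g => by
      classical
      ext1 m
      change (m.degree : ℚ) • MvPowerSeries.coeff m (f * g) = _
      rw [MvPowerSeries.coeff_mul, Finset.smul_sum, smul_eq_mul, smul_eq_mul, mul_comm g, map_add,
        MvPowerSeries.coeff_mul, MvPowerSeries.coeff_mul, ← Finset.sum_add_distrib]
      refine Finset.sum_congr rfl fun p hp => ?_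
      rw [← Finset.HasAntidiagonal.mem_antidiagonal.1 hp, map_add, Nat.cast_add, add_smul, add_comm]
      refine congrArg₂ _ ?_ ?_
      · exact (mul_smul_comm _ (MvPowerSeries.coeff p.1 f) (MvPowerSeries.coeff p.2 g)).symm
      · exact (smul_mul_assoc _ (MvPowerSeries.coeff p.1 f) (MvPowerSeries.coeff p.2 g)).symm

theorem coeff_euler (f : S) (m : ℕ →₀ ℕ) :
    MvPowerSeries.coeff m (euler f) = (m.degree : ℚ) • MvPowerSeries.coeff m f := rfl

theorem euler_C (r : R) : euler (MvPowerSeries.C r) = 0 := by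
  classical
  ext1 m
  rw [coeff_euler, MvPowerSeries.coeff_C]
  split_ifs with h
  · simp [h]
  · simp

theorem mapDer_comm (a b a' b' : ℤ) (f : S) :
    mapDer (eigenDer a b) (mapDer (eigenDer a' b') f) =
      mapDer (eigenDer a' b') (mapDer (eigenDer a b) f) := by
  ext1 m
  refine R_ext fun i j => ?_
  simp only [coeff_mapDer, coeff_eigenDer]
  ring

theorem thetaV_thetaY (f : S) : thetaV (thetaY f) = thetaY (thetaV f) := mapDer_comm _ _ _ _ f

theorem euler_mapDer (d : Derivation ℚ R R) (f : S) :
    euler (mapDer d f) = mapDer d (euler f) := by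
  ext1 m
  rw [coeff_euler, coeff_mapDer, coeff_mapDer, coeff_euler, d.map_smul]

/-! ### Constant terms in `v` and `y` -/

/-- The constant term with respect to `v` and `y`. -/
def CT : S →ₗ[ℚ] MvPowerSeries ℕ ℚ where
  toFun f m := ((MvPowerSeries.coeff m f).coeff 0).coeff 0
  map_add' _ _ := rfl
  map_smul' _ _ := rfl

theorem coeff_CT (f : S) (m : ℕ →₀ ℕ) :
    MvPowerSeries.coeff m (CT f) = ((MvPowerSeries.coeff m f).coeff 0).coeff 0 := rfl

theorem CT_thetaV (f : S) : CT (thetaV f) = 0 := by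
  ext1 m
  rw [coeff_CT, thetaV, coeff_mapDer, coeff_eigenDer]
  simp

theorem CT_thetaY (f : S) : CT (thetaY f) = 0 := by
  ext1 m
  rw [coeff_CT, thetaY, coeff_mapDer, coeff_eigenDer]
  simp

theorem coeffVY_eq_CT (i j : ℤ) (f : S) :
    coeffVY i j f = CT (f * MvPowerSeries.C (mono 1 (-i) (-j))) := by
  ext1 m
  rw [coeff_CT, MvPowerSeries.coeff_mul_C, coeff_coeff_mul_mono]
  simp only [sub_neg_eq_add, zero_add, mul_one]
  rfl

/-! ### Identifying two copies of the variables -/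

/-- Both sides sum over all splittings of `m` into four parts, and the middle two are swapped. This
is what makes `diag` multiplicative. -/
theorem sum_antidiagonal_interchange {M : Type*} [AddCommMonoid M]
    (F : (ℕ →₀ ℕ) → (ℕ →₀ ℕ) → (ℕ →₀ ℕ) → (ℕ →₀ ℕ) → M) (m : ℕ →₀ ℕ) :
    ∑ p ∈ Finset.HasAntidiagonal.antidiagonal m, ∑ q ∈ Finset.HasAntidiagonal.antidiagonal p.1, ∑ r ∈ Finset.HasAntidiagonal.antidiagonal p.2,
      F q.1 q.2 r.1 r.2 =
    ∑ p ∈ Finset.HasAntidiagonal.antidiagonal m, ∑ q ∈ Finset.HasAntidiagonal.antidiagonal p.1, ∑ r ∈ Finset.HasAntidiagonal.antidiagonal p.2,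
      F q.1 r.1 q.2 r.2 := by
  simp only [← Finset.sum_product', Finset.sum_sigma']
  refine Finset.sum_nbij'
    (fun x => ⟨(x.2.1.1 + x.2.2.1, x.2.1.2 + x.2.2.2), ((x.2.1.1, x.2.2.1), (x.2.1.2, x.2.2.2))⟩)
    (fun x => ⟨(x.2.1.1 + x.2.2.1, x.2.1.2 + x.2.2.2), ((x.2.1.1, x.2.2.1), (x.2.1.2, x.2.2.2))⟩)
    ?_ ?_ ?_ ?_ ?_
  · rintro ⟨⟨a, b⟩, ⟨⟨c, d⟩, ⟨e, f⟩⟩⟩ h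
    simp only [Finset.mem_sigma, Finset.HasAntidiagonal.mem_antidiagonal, Finset.mem_product] at h ⊢
    obtain ⟨h, rfl, rfl⟩ := h
    exact ⟨by rw [← h]; abel, trivial, trivial⟩
  · rintro ⟨⟨a, b⟩, ⟨⟨c, d⟩, ⟨e, f⟩⟩⟩ h
    simp only [Finset.mem_sigma, Finset.HasAntidiagonal.mem_antidiagonal, Finset.mem_product] at h ⊢
    obtain ⟨h, rfl, rfl⟩ := h
    exact ⟨by rw [← h]; abel, trivial, trivial⟩
  · rintro ⟨⟨a, b⟩, ⟨⟨c, d⟩, ⟨e, f⟩⟩⟩ h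
    simp only [Finset.mem_sigma, Finset.HasAntidiagonal.mem_antidiagonal, Finset.mem_product] at h
    obtain ⟨h, rfl, rfl⟩ := h
    rfl
  · rintro ⟨⟨a, b⟩, ⟨⟨c, d⟩, ⟨e, f⟩⟩⟩ h
    simp only [Finset.mem_sigma, Finset.HasAntidiagonal.mem_antidiagonal, Finset.mem_product] at h
    obtain ⟨h, rfl, rfl⟩ := h
    rfl
  · intros
    rfl

/-- The homomorphism identifying the two sets of variables of a power series in the `c_a` with
coefficients that are themselves power series in the `c_a`. -/
def diag : MvPowerSeries ℕ S →+* S where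
  toFun f m := ∑ p ∈ Finset.HasAntidiagonal.antidiagonal m, MvPowerSeries.coeff p.2 (MvPowerSeries.coeff p.1 f)
  map_zero' := by
    ext1 m
    exact Finset.sum_eq_zero fun p _ => rfl
  map_add' f g := by
    ext1 m
    exact Finset.sum_add_distrib
  map_one' := by
    classical
    ext1 m
    refine (Finset.sum_eq_single (0, m) ?_ ?_).trans ?_
    · rintro ⟨a, b⟩ h hne
      rw [MvPowerSeries.coeff_one, if_neg, map_zero]
      rintro rfl
      rw [Finset.HasAntidiagonal.mem_antidiagonal, zero_add] at h
      exact hne (congrArg _ h)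
    · intro h
      exact absurd (Finset.HasAntidiagonal.mem_antidiagonal.2 (zero_add m)) h
    · rw [MvPowerSeries.coeff_zero_one]
  map_mul' f g := by
    classical
    ext1 m
    refine Eq.trans ?_ (MvPowerSeries.coeff_mul _ _ _).symm
    change ∑ p ∈ Finset.HasAntidiagonal.antidiagonal m, MvPowerSeries.coeff p.2 (MvPowerSeries.coeff p.1 (f * g)) =
      ∑ p ∈ Finset.HasAntidiagonal.antidiagonal m,
        (∑ q ∈ Finset.HasAntidiagonal.antidiagonal p.1, MvPowerSeries.coeff q.2 (MvPowerSeries.coeff q.1 f)) *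
        (∑ r ∈ Finset.HasAntidiagonal.antidiagonal p.2, MvPowerSeries.coeff r.2 (MvPowerSeries.coeff r.1 g))
    simp only [MvPowerSeries.coeff_mul, map_sum, Finset.sum_mul_sum]
    exact sum_antidiagonal_interchange (fun a b c d =>
      MvPowerSeries.coeff c (MvPowerSeries.coeff a f) *
        MvPowerSeries.coeff d (MvPowerSeries.coeff b g)) m

theorem coeff_diag (f : MvPowerSeries ℕ S) (m : ℕ →₀ ℕ) :
    MvPowerSeries.coeff m (diag f) =
      ∑ p ∈ Finset.HasAntidiagonal.antidiagonal m, MvPowerSeries.coeff p.2 (MvPowerSeries.coeff p.1 f) := rfl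

theorem diag_C (s : S) : diag (MvPowerSeries.C s) = s := by
  classical
  ext1 m
  rw [coeff_diag]
  refine (Finset.sum_eq_single (0, m) ?_ ?_).trans ?_
  · rintro ⟨a, b⟩ h hne
    rw [MvPowerSeries.coeff_C, if_neg, map_zero]
    rintro rfl
    rw [Finset.HasAntidiagonal.mem_antidiagonal, zero_add] at h
    exact hne (congrArg _ h)
  · intro h
    exact absurd (Finset.HasAntidiagonal.mem_antidiagonal.2 (zero_add m)) h
  · rw [MvPowerSeries.coeff_zero_C]

/-! ### Logarithmic derivatives -/

/-- The logarithmic derivative of a unit. -/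
def dlog (δ : Derivation ℚ S S) (u : Sˣ) : S := ↑u⁻¹ * δ u

theorem mul_dlog (δ : Derivation ℚ S S) (u : Sˣ) : u * dlog δ u = δ u := by
  rw [dlog, Units.mul_inv_cancel_left]

theorem dlog_mul (δ : Derivation ℚ S S) (u w : Sˣ) : dlog δ (u * w) = dlog δ u + dlog δ w := by
  rw [dlog, Units.val_mul, δ.leibniz, smul_eq_mul, smul_eq_mul, ← mul_dlog δ u, ← mul_dlog δ w,
    show (u : S) * (w * dlog δ w) + w * (u * dlog δ u) = ↑(u * w) * (dlog δ u + dlog δ w) by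
      rw [Units.val_mul]; ring, Units.inv_mul_cancel_left]

theorem dlog_zpow (δ : Derivation ℚ S S) (u : Sˣ) (n : ℤ) : dlog δ (u ^ n) = n * dlog δ u := by
  let F : Sˣ →* Multiplicative S :=
    MonoidHom.mk' (fun u => Multiplicative.ofAdd (dlog δ u)) fun u w => by
      rw [dlog_mul]; rfl
  have : F (u ^ n) = F u ^ n := map_zpow F u n
  rw [← zsmul_eq_mul]
  exact this

theorem derivation_zpow (δ : Derivation ℚ S S) (u : Sˣ) (n : ℤ) :
    δ (↑(u ^ n)) = ↑(u ^ n) * (n * dlog δ u) := by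
  rw [← dlog_zpow, mul_dlog]

theorem derivation_inv (δ : Derivation ℚ S S) (u : Sˣ) :
    δ (↑(u⁻¹)) = -(↑(u⁻¹) * dlog δ u) := by
  have := derivation_zpow δ u (-1)
  rw [zpow_neg_one] at this
  rw [this]
  push_cast
  ring

/-- The form `d log u` is closed. -/
theorem dlog_comm (δ ε : Derivation ℚ S S) (h : ∀ f, δ (ε f) = ε (δ f)) (u : Sˣ) :
    δ (dlog ε u) = ε (dlog δ u) := by
  simp only [dlog, δ.leibniz, ε.leibniz, derivation_inv, h, smul_eq_mul]
  ring

/-! ### Substitutions -/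

/-- The substitution `v ↦ k`, `y ↦ g`. -/
def phi (k g : Sˣ) : R →+* S :=
  LaurentPolynomial.eval₂ (LaurentPolynomial.eval₂ (algebraMap ℚ S) k) g

theorem phi_mono (k g : Sˣ) (q : ℚ) (i j : ℤ) :
    phi k g (mono q i j) = algebraMap ℚ S q * ↑(k ^ i) * ↑(g ^ j) := by
  rw [phi, mono, LaurentPolynomial.eval₂_C_mul_T, LaurentPolynomial.eval₂_C_mul_T]

theorem phi_v (k g : Sˣ) (i : ℤ) : phi k g (v i) = ↑(k ^ i) := by
  rw [v_eq, phi_mono]; simp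

theorem phi_y (k g : Sˣ) (j : ℤ) : phi k g (y j) = ↑(g ^ j) := by
  rw [y_eq, phi_mono]; simp

/-- The chain rule in logarithmic coordinates, which needs checking only on monomials. -/
theorem derivation_phi (δ : Derivation ℚ S S) (k g : Sˣ) (r : R) :
    δ (phi k g r) =
      phi k g (eigenDer 1 0 r) * dlog δ k + phi k g (eigenDer 0 1 r) * dlog δ g := by
  refine eq_of_linear (f := fun r => δ (phi k g r))
    (g := fun r => phi k g (eigenDer 1 0 r) * dlog δ k + phi k g (eigenDer 0 1 r) * dlog δ g)
    (fun a b => ?_) (fun a b => ?_) (fun q i j => ?_) r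
  · simp only [map_add]
  · simp only [map_add]; ring
  · simp only [eigenDer_mono, phi_mono, Derivation.leibniz, derivation_zpow, smul_eq_mul,
      Derivation.map_algebraMap, map_mul, map_intCast]
    push_cast
    ring

/-- The substitution `v ↦ k`, `y ↦ g`, `c_a ↦ c_a`. -/
def sub (k g : Sˣ) : S →+* S := diag.comp (MvPowerSeries.map (phi k g))

theorem sub_apply (k g : Sˣ) (f : S) : sub k g f = diag (MvPowerSeries.map (phi k g) f) := rfl

theorem sub_C (k g : Sˣ) (r : R) : sub k g (MvPowerSeries.C r) = phi k g r := by
  rw [sub_apply, MvPowerSeries.map_C, diag_C]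

theorem coeff_sub (k g : Sˣ) (f : S) (m : ℕ →₀ ℕ) :
    MvPowerSeries.coeff m (sub k g f) = ∑ p ∈ Finset.HasAntidiagonal.antidiagonal m,
      MvPowerSeries.coeff p.2 (phi k g (MvPowerSeries.coeff p.1 f)) := by
  simp only [sub_apply, coeff_diag, MvPowerSeries.coeff_map]

theorem coeff_sub_mul (k g : Sˣ) (f s : S) (m : ℕ →₀ ℕ) :
    MvPowerSeries.coeff m (sub k g f * s) = ∑ p ∈ Finset.HasAntidiagonal.antidiagonal m,
      MvPowerSeries.coeff p.2 (phi k g (MvPowerSeries.coeff p.1 f) * s) := by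
  have : sub k g f * s = diag (MvPowerSeries.map (phi k g) f * MvPowerSeries.C s) := by
    rw [map_mul, diag_C, sub_apply]
  simp only [this, coeff_diag, MvPowerSeries.coeff_mul_C, MvPowerSeries.coeff_map]

theorem mapDer_sub (d : Derivation ℚ R R) (k g : Sˣ) (f : S) :
    mapDer d (sub k g f) = sub k g (thetaV f) * dlog (mapDer d) k +
      sub k g (thetaY f) * dlog (mapDer d) g := by
  ext1 m
  rw [coeff_mapDer, map_add, coeff_sub_mul, coeff_sub_mul, coeff_sub, map_sum,
    ← Finset.sum_add_distrib]
  refine Finset.sum_congr rfl fun p _ => ?_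
  rw [← coeff_mapDer, derivation_phi, map_add]
  rfl

/-- The `c_a` occur both explicitly in `f` and through `k` and `g`; the first term accounts for the
former, the other two for the latter. -/
theorem euler_sub (k g : Sˣ) (f : S) :
    euler (sub k g f) = sub k g (euler f) + (sub k g (thetaV f) * dlog euler k +
      sub k g (thetaY f) * dlog euler g) := by
  ext1 m
  rw [coeff_euler, map_add, map_add, coeff_sub_mul, coeff_sub_mul, coeff_sub, coeff_sub,
    Finset.smul_sum, ← Finset.sum_add_distrib, ← Finset.sum_add_distrib]
  refine Finset.sum_congr rfl fun p hp => ?_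
  have h := congrArg (MvPowerSeries.coeff p.2)
    (derivation_phi euler k g (MvPowerSeries.coeff p.1 f))
  rw [coeff_euler, map_add] at h
  rw [← Finset.HasAntidiagonal.mem_antidiagonal.1 hp, map_add, Nat.cast_add, add_smul, h,
    coeff_euler]
  refine congrArg₂ _ ?_ rfl
  rw [← coeff_qsmul, Algebra.smul_def, Algebra.smul_def, map_mul (phi k g)]
  congr 2
  simp

theorem thetaV_sub (k g : Sˣ) (f : S) :
    thetaV (sub k g f) = sub k g (thetaV f) * dlog thetaV k + sub k g (thetaY f) * dlog thetaV g :=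
  mapDer_sub _ k g f

theorem thetaY_sub (k g : Sˣ) (f : S) :
    thetaY (sub k g f) = sub k g (thetaV f) * dlog thetaY k + sub k g (thetaY f) * dlog thetaY g :=
  mapDer_sub _ k g f

/-- The Poisson bracket of `f` and `g` with respect to `log v` and `log y`. -/
def bracket (f g : S) : S := thetaV f * thetaY g - thetaY f * thetaV g

/-- The Jacobian determinant of `log k` and `log g` with respect to `log v` and `log y`. -/
def jac (k g : Sˣ) : S := dlog thetaV k * dlog thetaY g - dlog thetaY k * dlog thetaV g

theorem bracket_sub (k g : Sˣ) (a b : S) :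
    bracket (sub k g a) (sub k g b) = sub k g (bracket a b) * jac k g := by
  simp only [bracket, thetaV_sub, thetaY_sub, jac, map_sub, map_mul]
  ring

/-- Since `d log u` is closed, `d log u ∧ df` is exact, and `v d/dv` and `y d/dy` kill constant
terms. -/
theorem CT_dlog_bracket (u : Sˣ) (f : S) :
    CT (dlog thetaV u * thetaY f - dlog thetaY u * thetaV f) = 0 := by
  have h : dlog thetaV u * thetaY f - dlog thetaY u * thetaV f =
      thetaY (dlog thetaV u * f) - thetaV (dlog thetaY u * f) := by
    rw [Derivation.leibniz, Derivation.leibniz, dlog_comm thetaV thetaY thetaV_thetaY]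
    simp only [smul_eq_mul]
    ring
  rw [h, map_sub, CT_thetaY, CT_thetaV, sub_zero]

/-- Moving `k` and `g` changes `d log k ∧ d log g` by an exact form. Hence the Euler derivative of
the Jacobian has zero constant term, and only degree 0 in the `c_a` survives. -/
theorem CT_jac (k g : Sˣ) : CT (jac k g) =
    MvPowerSeries.C (((MvPowerSeries.constantCoeff (jac k g)).coeff 0).coeff 0) := by
  classical
  have h : euler (jac k g) =
      (dlog thetaV k * thetaY (dlog euler g) - dlog thetaY k * thetaV (dlog euler g)) -
      (dlog thetaV g * thetaY (dlog euler k) - dlog thetaY g * thetaV (dlog euler k)) := by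
    rw [jac, map_sub, Derivation.leibniz, Derivation.leibniz]
    rw [dlog_comm euler thetaV (euler_mapDer _), dlog_comm euler thetaY (euler_mapDer _),
      dlog_comm euler thetaV (euler_mapDer _), dlog_comm euler thetaY (euler_mapDer _)]
    simp only [smul_eq_mul]
    ring
  have h0 : CT (euler (jac k g)) = 0 := by
    rw [h, map_sub, CT_dlog_bracket, CT_dlog_bracket, sub_zero]
  ext1 m
  rw [MvPowerSeries.coeff_C]
  split_ifs with hm
  · rw [hm]; rfl
  · have h1 := congrArg (MvPowerSeries.coeff m) h0
    rw [coeff_CT, coeff_euler] at h1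
    have h2 : (m.degree : ℚ) * ((MvPowerSeries.coeff m (jac k g)).coeff 0).coeff 0 = 0 := h1
    rw [coeff_CT]
    refine (mul_eq_zero.1 h2).resolve_left ?_
    exact fun h => hm ((Finsupp.degree_eq_zero_iff m).1 (Nat.cast_eq_zero.1 h))

/-- For a nontrivial monomial, `k^i g^j d log k ∧ d log g` is exact: up to a nonzero factor it is `d
log k ∧ d(k^i g^j)` if `j ≠ 0`, and `d log g ∧ d(k^i)` if `j = 0` and `i ≠ 0`. -/
theorem CT_phi_mul_jac (k g : Sˣ) (r : R) :
    CT (phi k g r * jac k g) = (r.coeff 0).coeff 0 • CT (jac k g) := by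
  refine eq_of_linear (f := fun r => CT (phi k g r * jac k g))
    (g := fun r => (r.coeff 0).coeff 0 • CT (jac k g))
    (fun a b => ?_) (fun a b => ?_) (fun q i j => ?_) r
  · simp only [map_add, add_mul]
  · exact add_smul ((a.coeff 0).coeff 0) ((b.coeff 0).coeff 0) _
  · simp only [coeff_mono, phi_mono]
    rw [mul_assoc, mul_assoc, ← Algebra.smul_def, map_smul]
    by_cases hj : j = 0
    · by_cases hi : i = 0
      · simp [hi, hj]
      · have h := CT_dlog_bracket g (↑(k ^ i))
        rw [derivation_zpow, derivation_zpow] at h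
        have h1 : dlog thetaV g * (↑(k ^ i) * (i * dlog thetaY k)) -
            dlog thetaY g * (↑(k ^ i) * (i * dlog thetaV k)) =
            ((-i : ℤ) : ℚ) • (↑(k ^ i) * (↑(g ^ j) * jac k g)) := by
          rw [Algebra.smul_def, map_intCast, hj, jac, zpow_zero]
          push_cast
          ring
        rw [h1, map_smul] at h
        rw [(smul_eq_zero.1 h).resolve_left (by simpa using hi)]
        simp [hi]
    · have h := CT_dlog_bracket k (↑(k ^ i) * ↑(g ^ j))
      have h1 : dlog thetaV k * thetaY (↑(k ^ i) * ↑(g ^ j)) -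
            dlog thetaY k * thetaV (↑(k ^ i) * ↑(g ^ j)) =
            (j : ℚ) • (↑(k ^ i) * (↑(g ^ j) * jac k g)) := by
        rw [Algebra.smul_def, map_intCast, jac, Derivation.leibniz, Derivation.leibniz]
        simp only [derivation_zpow, smul_eq_mul]
        ring
      rw [h1, map_smul] at h
      rw [(smul_eq_zero.1 h).resolve_left (by simpa using hj)]
      simp [hj]

/-- Change of variables for the constant term. -/
theorem CT_sub_mul_jac (k g : Sˣ) (c : ℚ)
    (hc : ((MvPowerSeries.constantCoeff (jac k g)).coeff 0).coeff 0 = c) (f : S) :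
    CT (sub k g f * jac k g) = c • CT f := by
  classical
  ext1 m
  rw [coeff_CT, coeff_sub_mul]
  -- Each coefficient of `f` contributes only its `(v, y)`-constant term, times a Jacobian constant
  -- term free of the `c_a`.
  have h : ∀ p : (ℕ →₀ ℕ) × (ℕ →₀ ℕ), ((MvPowerSeries.coeff p.2
      (phi k g (MvPowerSeries.coeff p.1 f) * jac k g)).coeff 0).coeff 0 =
      if p.2 = 0 then ((MvPowerSeries.coeff p.1 f).coeff 0).coeff 0 * c else 0 := fun p => by
    rw [← coeff_CT, CT_phi_mul_jac, CT_jac, hc, MvPowerSeries.smul_eq_C_mul, ← map_mul,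
      MvPowerSeries.coeff_C]
  have h' : ((∑ p ∈ Finset.HasAntidiagonal.antidiagonal m, MvPowerSeries.coeff p.2
      (phi k g (MvPowerSeries.coeff p.1 f) * jac k g)).coeff 0).coeff 0 =
      ∑ p ∈ Finset.HasAntidiagonal.antidiagonal m, ((MvPowerSeries.coeff p.2
      (phi k g (MvPowerSeries.coeff p.1 f) * jac k g)).coeff 0).coeff 0 := by
    simp [AddMonoidAlgebra.coeff_sum, Finsupp.finsetSum_apply]
  rw [h', Finset.sum_congr rfl fun p _ => h p, Finset.sum_eq_single (m, 0)]
  · rw [if_pos rfl, mul_comm]; rfl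
  · rintro ⟨a, b⟩ hab hne
    refine if_neg fun hb : b = 0 => hne ?_
    rw [Finset.HasAntidiagonal.mem_antidiagonal] at hab
    subst hb
    rw [← hab, add_zero]
  · intro hm
    exact absurd (Finset.HasAntidiagonal.mem_antidiagonal.2 (add_zero m)) hm

/-! ### The filtration by degree in the `c_a` -/

/-- The ideal of power series all of whose terms have degree at least `n` in the `c_a`. -/
def J (n : ℕ) : Ideal S where
  carrier := {f | ∀ m : ℕ →₀ ℕ, m.degree < n → MvPowerSeries.coeff m f = 0}
  add_mem' {f g} hf hg m hm := by rw [map_add, hf m hm, hg m hm, add_zero]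
  zero_mem' m _ := rfl
  smul_mem' c f hf m hm := by
    classical
    rw [smul_eq_mul, MvPowerSeries.coeff_mul]
    refine Finset.sum_eq_zero fun p hp => ?_
    rw [hf p.2, mul_zero]
    refine lt_of_le_of_lt ?_ hm
    rw [← Finset.HasAntidiagonal.mem_antidiagonal.1 hp, map_add]
    exact Nat.le_add_left _ _

theorem mem_J {n : ℕ} {f : S} :
    f ∈ J n ↔ ∀ m : ℕ →₀ ℕ, m.degree < n → MvPowerSeries.coeff m f = 0 := Iff.rfl

theorem J_mono {a b : ℕ} (h : a ≤ b) : J b ≤ J a := fun _ hf m hm => hf m (hm.trans_le h)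

theorem mul_mem_J {a b : ℕ} {f g : S} (hf : f ∈ J a) (hg : g ∈ J b) : f * g ∈ J (a + b) := by
  classical
  intro m hm
  rw [MvPowerSeries.coeff_mul]
  refine Finset.sum_eq_zero fun p hp => ?_
  have h := congrArg Finsupp.degree (Finset.HasAntidiagonal.mem_antidiagonal.1 hp)
  rw [map_add] at h
  by_cases h1 : p.1.degree < a
  · rw [hf _ h1, zero_mul]
  · rw [hg p.2 (by omega), mul_zero]

theorem eq_zero_of_mem_J {f : S} (h : ∀ n, f ∈ J n) : f = 0 := by
  ext1 m
  exact h (m.degree + 1) m (Nat.lt_succ_self _)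

theorem mem_J_one {f : S} : f ∈ J 1 ↔ MvPowerSeries.constantCoeff f = 0 := by
  rw [mem_J]
  constructor
  · intro h
    exact h 0 (by simp)
  · intro h m hm
    rw [(Finsupp.degree_eq_zero_iff m).1 (Nat.lt_one_iff.1 hm)]
    exact h

theorem mapDer_mem_J (d : Derivation ℚ R R) {n : ℕ} {f : S} (hf : f ∈ J n) : mapDer d f ∈ J n := by
  intro m hm
  rw [coeff_mapDer, hf m hm, map_zero]

theorem isUnit_of_constantCoeff {f : S} (u : Rˣ) (h : MvPowerSeries.constantCoeff f = u) :
    IsUnit f :=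
  ⟨⟨f, MvPowerSeries.invOfUnit f u, MvPowerSeries.mul_invOfUnit _ _ h,
    MvPowerSeries.invOfUnit_mul _ _ h⟩, rfl⟩

/-! ### The linear series `∑ c_a u ^ a` -/

/-- The series `∑ c_a u ^ a`. -/
def genP {K : Type*} [CommRing K] (u : K) : MvPowerSeries ℕ K :=
  fun m => if m.degree = 1 then u ^ (m.sum fun a n => a * n) else 0

theorem coeff_genP {K : Type*} [CommRing K] (u : K) (m : ℕ →₀ ℕ) :
    MvPowerSeries.coeff m (genP u) = if m.degree = 1 then u ^ (m.sum fun a n => a * n) else 0 := rfl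

theorem coeff_genP_single {K : Type*} [CommRing K] (u : K) (a : ℕ) :
    MvPowerSeries.coeff (Finsupp.single a 1) (genP u) = u ^ a := by
  rw [coeff_genP, if_pos (by simp), Finsupp.sum_single_index (by simp), mul_one]

theorem map_genP {K L : Type*} [CommRing K] [CommRing L] (ψ : K →+* L) (u : K) :
    MvPowerSeries.map ψ (genP u) = genP (ψ u) := by
  ext1 m
  rw [MvPowerSeries.coeff_map, coeff_genP, coeff_genP]
  split_ifs <;> simp

theorem exists_eq_single {m : ℕ →₀ ℕ} (h : m.degree = 1) : ∃ a, m = Finsupp.single a 1 := by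
  exact (Finsupp.sum_eq_one_iff m).1 h

theorem formalSum_termP : formalSum termP = genP (v 1 * (1 + y 1) ^ 2) := by
  ext1 m
  change ∑ᶠ a, MvPowerSeries.coeff m (termP a) = _
  by_cases hm : m.degree = 1
  · obtain ⟨a, rfl⟩ := exists_eq_single hm
    rw [finsum_eq_single _ a, coeff_genP_single, termP, MvPowerSeries.coeff_mul_C,
      MvPowerSeries.coeff_index_single_self_X, one_mul]
    intro b hb
    refine coeff_termP b _ fun h => hb ?_
    exact ((Finsupp.single_left_injective one_ne_zero) h).symm
  · rw [coeff_genP, if_neg hm]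
    refine (finsum_congr fun a => coeff_termP a m ?_).trans finsum_zero
    rintro rfl
    simp at hm

theorem A_eq : A = MvPowerSeries.C (v (-1)) * genP (v 1 * (1 + y 1) ^ 2) := by
  rw [A, formalSum_termP]

/-- The series `∑ c_a u ^ a` for `u` a power series in the `c_a`. -/
def lin (u : S) : S := diag (genP u)

theorem diag_map_C (f : S) : diag (MvPowerSeries.map MvPowerSeries.C f) = f := by
  classical
  ext1 m
  rw [coeff_diag, Finset.sum_eq_single (m, 0)]
  · rw [MvPowerSeries.coeff_map, MvPowerSeries.coeff_zero_C]
  · rintro ⟨a, b⟩ hab hne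
    rw [MvPowerSeries.coeff_map, MvPowerSeries.coeff_C]
    refine if_neg fun hb : b = 0 => hne ?_
    rw [Finset.HasAntidiagonal.mem_antidiagonal] at hab
    subst hb
    rw [← hab, add_zero]
  · intro hm
    exact absurd (Finset.HasAntidiagonal.mem_antidiagonal.2 (add_zero m)) hm

theorem lin_C (u : R) : lin (MvPowerSeries.C u) = genP u := by
  rw [lin, ← map_genP, diag_map_C]

theorem sub_genP (k g : Sˣ) (u : R) : sub k g (genP u) = lin (phi k g u) := by
  rw [sub_apply, map_genP, lin]

theorem lin_mem_J (u : S) : lin u ∈ J 1 := by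
  intro m hm
  rw [lin, coeff_diag]
  refine Finset.sum_eq_zero fun p hp => ?_
  have h := congrArg Finsupp.degree (Finset.HasAntidiagonal.mem_antidiagonal.1 hp)
  rw [map_add] at h
  rw [coeff_genP, if_neg (by omega), map_zero]

/-- Every term carries an explicit factor `c_a`, so one degree is gained. This gain is what makes
the implicit equation contracting. -/
theorem lin_sub_mem_J {u u' : S} {n : ℕ} (h : u - u' ∈ J n) : lin u - lin u' ∈ J (n + 1) := by
  intro m hm
  rw [lin, lin, map_sub, coeff_diag, coeff_diag, ← Finset.sum_sub_distrib]
  refine Finset.sum_eq_zero fun p hp => ?_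
  have h' := congrArg Finsupp.degree (Finset.HasAntidiagonal.mem_antidiagonal.1 hp)
  rw [map_add] at h'
  rw [coeff_genP, coeff_genP, ← map_sub]
  split_ifs with h1
  · exact Ideal.mem_of_dvd _ (sub_dvd_pow_sub_pow _ _ _) h _ (by omega)
  · rw [sub_zero, map_zero]

/-! ### The implicit function -/

/-- The contraction principle for the filtration `J`. -/
theorem exists_fixedPoint (Ψ : S → S) (c : S) (h0 : ∀ f, f - c ∈ J 1 → Ψ f - c ∈ J 1)
    (h : ∀ f f' n, f - c ∈ J 1 → f' - c ∈ J 1 → f - f' ∈ J n → Ψ f - Ψ f' ∈ J (n + 1)) :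
    ∃ t, t - c ∈ J 1 ∧ Ψ t = t := by
  let a : ℕ → S := fun n => Ψ^[n] c
  have ha (n) : a (n + 1) = Ψ (a n) := Function.iterate_succ_apply' Ψ n c
  have h1 (n) : a n - c ∈ J 1 := by
    induction n with
    | zero => rw [show a 0 = c from rfl, sub_self]; exact zero_mem _
    | succ n ih => rw [ha]; exact h0 _ ih
  have h2 (n) : a (n + 1) - a n ∈ J (n + 1) := by
    induction n with
    | zero => exact h1 1
    | succ n ih =>
      have := h _ _ _ (h1 (n + 1)) (h1 n) ih
      rwa [← ha, ← ha] at this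
  have h3 (n k) : a (n + k) - a n ∈ J (n + 1) := by
    induction k with
    | zero => simp
    | succ k ih =>
      have := add_mem (J_mono (by omega) (h2 (n + k))) ih
      rwa [sub_add_sub_cancel] at this
  -- The coefficient at `m` no longer changes from the iterate of index `m.degree` on.
  let t : S := fun m => MvPowerSeries.coeff m (a m.degree)
  have h4 (n) : t - a n ∈ J (n + 1) := by
    intro m hm
    obtain ⟨k, rfl⟩ := Nat.exists_eq_add_of_le (Nat.lt_succ_iff.1 hm)
    have := h3 m.degree k m (Nat.lt_succ_self _)
    rw [map_sub, sub_eq_zero] at this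
    rw [map_sub, this, sub_eq_zero]
    rfl
  have h5 : t - c ∈ J 1 := h4 0
  refine ⟨t, h5, ?_⟩
  rw [← sub_eq_zero]
  refine eq_zero_of_mem_J fun n => ?_
  have h6 := sub_mem (h _ _ _ h5 (h1 n) (h4 n)) (J_mono (by omega) (h4 (n + 1)))
  rw [ha, sub_sub_sub_cancel_right] at h6
  exact J_mono (by omega) h6

theorem C_v_mul (i j : ℤ) : (MvPowerSeries.C (v i) : S) * MvPowerSeries.C (v j) =
    MvPowerSeries.C (v (i + j)) := by
  rw [← map_mul, v_eq, v_eq, v_eq, mono_mul]; norm_num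

theorem C_y_mul (i j : ℤ) : (MvPowerSeries.C (y i) : S) * MvPowerSeries.C (y j) =
    MvPowerSeries.C (y (i + j)) := by
  rw [← map_mul, y_eq, y_eq, y_eq, mono_mul]; norm_num

theorem y_zero : y 0 = 1 := by rw [y_eq, one_eq_mono]

theorem v_zero : v 0 = 1 := by rw [v_eq, one_eq_mono]

/-- The unit `v` of `S`. -/
def vU : Sˣ where
  val := MvPowerSeries.C (v 1)
  inv := MvPowerSeries.C (v (-1))
  val_inv := by rw [C_v_mul, add_neg_cancel, v_zero, map_one]
  inv_val := by rw [C_v_mul, neg_add_cancel, v_zero, map_one]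

/-- The unit `y` of `S`. -/
def yU : Sˣ where
  val := MvPowerSeries.C (y 1)
  inv := MvPowerSeries.C (y (-1))
  val_inv := by rw [C_y_mul, add_neg_cancel, y_zero, map_one]
  inv_val := by rw [C_y_mul, neg_add_cancel, y_zero, map_one]

theorem vU_val : (vU : S) = MvPowerSeries.C (v 1) := rfl

theorem yU_val : (yU : S) = MvPowerSeries.C (y 1) := rfl

theorem vU_inv : (↑vU⁻¹ : S) = MvPowerSeries.C (v (-1)) := rfl

theorem yU_inv : (↑yU⁻¹ : S) = MvPowerSeries.C (y (-1)) := rfl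

theorem qsmul_mem_J (q : ℚ) {n : ℕ} {f : S} (h : f ∈ J n) : q • f ∈ J n := by
  intro m hm
  rw [coeff_qsmul, h m hm, smul_zero]

theorem half_smul_two : (1 / 2 : ℚ) • (2 : S) = 1 := by
  rw [Algebra.smul_def, ← map_ofNat (algebraMap ℚ S) 2, ← map_mul]
  norm_num

theorem half_smul_two_mul (f : S) : (1 / 2 : ℚ) • (2 * f) = f := by
  rw [← smul_mul_assoc, half_smul_two, one_mul]

theorem two_mul_half_smul (f : S) : 2 * ((1 / 2 : ℚ) • f) = f := by
  rw [mul_smul_comm, half_smul_two_mul]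

theorem exists_implicit : ∃ t : S, t - yU ∈ J 1 ∧
    t ^ 2 = yU ^ 2 + 2 * (↑vU⁻¹ * lin (vU * (1 + t) ^ 2)) := by
  -- Writing `t² - y² = 2y(t - y) + (t - y)²` turns the equation into `t = y + (2a - (t -
  -- y)²)/(2y)`, whose right side contracts near `y`.
  let Ψ : S → S := fun t => yU + (1 / 2 : ℚ) • (yU⁻¹ *
    (2 * (↑vU⁻¹ * lin (vU * (1 + t) ^ 2)) - (t - yU) ^ 2))
  suffices h : ∃ t : S, t - yU ∈ J 1 ∧ Ψ t = t by
    obtain ⟨t, h1, h2⟩ := h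
    refine ⟨t, h1, ?_⟩
    have h3 : 2 * ((1 / 2 : ℚ) • (↑yU⁻¹ *
      (2 * (↑vU⁻¹ * lin (vU * (1 + t) ^ 2)) - (t - yU) ^ 2))) = ↑yU⁻¹ *
      (2 * (↑vU⁻¹ * lin (vU * (1 + t) ^ 2)) - (t - yU) ^ 2) :=
      two_mul_half_smul _
    have h4 : 2 * (t - yU) = ↑yU⁻¹ *
      (2 * (↑vU⁻¹ * lin (vU * (1 + t) ^ 2)) - (t - yU) ^ 2) := by
      rw [← h3]
      linear_combination -2 * h2
    have h5 := congrArg ((yU : S) * ·) h4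
    simp only [Units.mul_inv_cancel_left] at h5
    linear_combination h5
  refine exists_fixedPoint Ψ yU ?_ ?_
  · intro f hf
    simp only [Ψ, add_sub_cancel_left]
    refine qsmul_mem_J _ (Ideal.mul_mem_left _ _ (sub_mem ?_ ?_))
    · exact Ideal.mul_mem_left _ _ (Ideal.mul_mem_left _ _ (lin_mem_J _))
    · rw [sq]
      exact Ideal.mul_mem_left _ _ hf
  · intro f f' n hf hf' h
    simp only [Ψ, add_sub_add_left_eq_sub, ← smul_sub, ← mul_sub]
    refine qsmul_mem_J _ (Ideal.mul_mem_left _ _ ?_)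
    rw [sub_sub_sub_comm]
    refine sub_mem ?_ ?_
    · rw [← mul_sub, ← mul_sub]
      refine Ideal.mul_mem_left _ _ (Ideal.mul_mem_left _ _ (lin_sub_mem_J ?_))
      have : (vU : S) * (1 + f) ^ 2 - vU * (1 + f') ^ 2 = vU * (2 + f + f') * (f - f') := by ring
      rw [this]
      exact Ideal.mul_mem_left _ _ h
    · have : (f - yU) ^ 2 - (f' - yU) ^ 2 = (f - f') * ((f - yU) + (f' - yU)) := by ring
      rw [this]
      exact mul_mem_J h (add_mem hf hf')

theorem two_mul_cancel {a b : S} (h : 2 * a = 2 * b) : a = b := by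
  have h2 : IsUnit (2 : S) := by
    have : IsUnit (algebraMap ℚ S 2) := (isUnit_iff_ne_zero.2 two_ne_zero).map _
    rwa [map_ofNat] at this
  exact h2.mul_left_cancel h

theorem thetaV_vU : thetaV (vU : S) = vU := by
  rw [vU_val, thetaV, mapDer_C, v_eq, eigenDer_mono]; norm_num

theorem thetaY_vU : thetaY (vU : S) = 0 := by
  rw [vU_val, thetaY, mapDer_C, v_eq, eigenDer_mono]; simp [mono]

theorem thetaV_yU : thetaV (yU : S) = 0 := by
  rw [yU_val, thetaV, mapDer_C, y_eq, eigenDer_mono]; simp [mono]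

theorem thetaY_yU : thetaY (yU : S) = yU := by
  rw [yU_val, thetaY, mapDer_C, y_eq, eigenDer_mono]; norm_num

theorem euler_vU : euler (vU : S) = 0 := euler_C _

theorem euler_yU : euler (yU : S) = 0 := euler_C _

/-! ### Lagrange inversion and the closed form of `T` -/

/-- `(1/y) d/dy` as a derivation. -/
def DDer : Derivation ℚ S S := (MvPowerSeries.C (y (-2)) : S) • thetaY

theorem DDer_apply (f : S) : DDer f = MvPowerSeries.C (y (-2)) * thetaY f := rfl

theorem D_eq : D = ⇑DDer := by
  funext f
  ext1 m
  rw [coeff_D, DDer_apply, MvPowerSeries.coeff_C_mul, y_mul_ddy]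
  rfl

theorem sq_mul_DDer (f : S) : (yU : S) ^ 2 * DDer f = thetaY f := by
  rw [DDer_apply, ← mul_assoc, yU_val, sq, C_y_mul, C_y_mul]
  norm_num [y_zero]

theorem euler_DDer (f : S) : euler (DDer f) = DDer (euler f) := by
  rw [DDer_apply, euler.leibniz, euler_C, smul_zero, add_zero, DDer_apply, thetaY, euler_mapDer,
    smul_eq_mul]

theorem DDer_mem_J {n : ℕ} {f : S} (hf : f ∈ J n) : DDer f ∈ J n :=
  Ideal.mul_mem_left _ _ (mapDer_mem_J _ hf)

theorem DDer_iterate_mem_J {n : ℕ} {f : S} (hf : f ∈ J n) (r : ℕ) : DDer^[r] f ∈ J n := by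
  induction r with
  | zero => exact hf
  | succ r ih => rw [Function.iterate_succ_apply']; exact DDer_mem_J ih

theorem DDer_iterate_sub (r : ℕ) (f g : S) : DDer^[r] (f - g) = DDer^[r] f - DDer^[r] g :=
  iterate_map_sub DDer r f g

theorem DDer_iterate_smul (r : ℕ) (q : ℚ) (f : S) : DDer^[r] (q • f) = q • DDer^[r] f := by
  induction r with
  | zero => rfl
  | succ r ih =>
    rw [Function.iterate_succ_apply', ih, Function.iterate_succ_apply', DDer.map_smul]

theorem euler_DDer_iterate (r : ℕ) (f : S) : euler (DDer^[r] f) = DDer^[r] (euler f) := by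
  induction r with
  | zero => rfl
  | succ r ih =>
    rw [Function.iterate_succ_apply', Function.iterate_succ_apply', euler_DDer, ih]

theorem euler_eq_self {f : S} (h : ∀ m : ℕ →₀ ℕ, m.degree ≠ 1 → MvPowerSeries.coeff m f = 0) :
    euler f = f := by
  ext1 m
  rw [coeff_euler]
  by_cases hm : m.degree = 1
  · rw [hm, Nat.cast_one, one_smul]
  · rw [h m hm, smul_zero]

theorem coeff_genP_of_ne {K : Type*} [CommRing K] (u : K) {m : ℕ →₀ ℕ} (hm : m.degree ≠ 1) :
    MvPowerSeries.coeff m (genP u) = 0 := by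
  rw [coeff_genP, if_neg hm]

theorem euler_genP (u : R) : euler (genP u) = genP u :=
  euler_eq_self fun _ hm => coeff_genP_of_ne u hm

theorem euler_A : euler A = A := by
  rw [A_eq, euler.leibniz, euler_C, smul_zero, add_zero, euler_genP, smul_eq_mul]

/-- `A ^ r` is homogeneous of degree `r`, being an eigenvector of `euler`. -/
theorem coeff_pow_A_of_ne {m : ℕ →₀ ℕ} {r : ℕ} (h : m.degree ≠ r) :
    MvPowerSeries.coeff m (A ^ r) = 0 := by
  have h1 : euler (A ^ r) = (r : ℚ) • A ^ r := by
    rw [euler.leibniz_pow, euler_A, Algebra.smul_def, map_natCast]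
    cases r with
    | zero => simp
    | succ r =>
      simp only [Nat.add_sub_cancel, smul_eq_mul, nsmul_eq_mul]
      ring
  have h2 := congrArg (MvPowerSeries.coeff m) h1
  rw [coeff_euler, coeff_qsmul, ← sub_eq_zero, ← sub_smul] at h2
  refine (smul_eq_zero.1 h2).resolve_left ?_
  rw [sub_eq_zero]
  exact_mod_cast h

theorem coeff_termT_of_ne {m : ℕ →₀ ℕ} {r : ℕ} (h : m.degree ≠ r + 1) :
    MvPowerSeries.coeff m (termT r) = 0 := by
  rw [termT, coeff_qsmul, coeff_iterate_D, smul_zero]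
  rw [MvPowerSeries.coeff_C_mul, coeff_pow_A_of_ne h, mul_zero]

/-- The Lagrange inversion formula, for a solution `t` of `euler t = a * DDer t`, in terms of a
function `b` of `t`. -/
theorem coeff_lagrange {a b : S} (ha : euler a = a + a * DDer a) (hb : euler b = a * DDer b)
    (r : ℕ) (m : ℕ →₀ ℕ) :
    MvPowerSeries.coeff m (DDer^[r] (a ^ (r + 1) * DDer b)) =
      (m.degree.descFactorial (r + 1) : ℚ) • MvPowerSeries.coeff m b := by
  induction r with
  | zero =>
    rw [Function.iterate_zero, id, zero_add, pow_one, ← hb, coeff_euler, Nat.descFactorial_one]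
  | succ r ih =>
    -- The two hypotheses give this identity; it adds the factor `m.degree - (r + 1)` at each step
    -- of the falling factorial.
    have h1 : euler (a ^ (r + 1) * DDer b) - ((r + 1 : ℕ) : ℚ) • (a ^ (r + 1) * DDer b) =
        DDer (a ^ (r + 1 + 1) * DDer b) := by
      rw [euler.leibniz, euler.leibniz_pow, euler_DDer, hb, ha, pow_succ a (r + 1), mul_assoc,
        DDer.leibniz (a ^ (r + 1)), DDer.leibniz_pow, DDer.leibniz a, Algebra.smul_def, map_natCast]
      simp only [smul_eq_mul, nsmul_eq_mul, Nat.add_sub_cancel]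
      ring
    rw [Function.iterate_succ_apply, ← h1, DDer_iterate_sub, DDer_iterate_smul,
      ← euler_DDer_iterate, map_sub, coeff_euler, coeff_qsmul, ih, ← sub_smul, smul_smul,
      Nat.descFactorial_succ m.degree (r + 1)]
    congr 1
    -- When the natural subtraction truncates, the falling factorial is already zero.
    rcases le_or_gt (r + 1) m.degree with h | h
    · rw [Nat.cast_mul, Nat.cast_sub h]
    · rw [Nat.descFactorial_of_lt h]
      simp

/-- The function `A(v, t)`. -/
theorem sub_A (t : Sˣ) : sub vU t A = ↑vU⁻¹ * lin (vU * (1 + t) ^ 2) := by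
  rw [A_eq, map_mul, sub_C, phi_v, zpow_neg_one, sub_genP, map_mul, map_pow, map_add, map_one,
    phi_v, phi_y, zpow_one, zpow_one]

theorem dlog_of_eq_zero {δ : Derivation ℚ S S} {u : Sˣ} (h : δ u = 0) : dlog δ u = 0 := by
  rw [dlog, h, mul_zero]

/-- Scaling all `c_a` turns the equation into `t² = y² + 2εA(v, t)`, and `euler` differentiates in
`log ε`. Comparison with the `y`-derivative gives the Burgers-type equations used by
`coeff_lagrange`. -/
theorem euler_implicit {t : Sˣ} (h2 : (t : S) ^ 2 = yU ^ 2 + 2 * sub vU t A) :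
    euler (t : S) = sub vU t A * DDer t ∧
    euler (sub vU t A) = sub vU t A + sub vU t A * DDer (sub vU t A) := by
  set a := sub vU t A with ha
  set b : S := sub vU t (thetaY A) * ↑t⁻¹
  have hy : thetaY a = b * thetaY t := by
    rw [ha, thetaY_sub, dlog_of_eq_zero thetaY_vU, dlog]
    ring
  have he : euler a = a + b * euler t := by
    rw [ha, euler_sub, dlog_of_eq_zero euler_vU, euler_A, dlog]
    ring
  have hD : DDer a = b * DDer t := by
    rw [DDer_apply, hy, DDer_apply]
    ring
  have k1 : (t - b) * thetaY t = yU ^ 2 := by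
    have := congrArg thetaY h2
    rw [map_add, thetaY.leibniz_pow, thetaY.leibniz_pow, thetaY_yU, thetaY.leibniz, hy,
      ← Nat.cast_ofNat (R := S), thetaY.map_natCast] at this
    simp only [smul_eq_mul, nsmul_eq_mul, Nat.cast_ofNat] at this
    refine two_mul_cancel ?_
    linear_combination this
  have k2 : (t - b) * euler t = a := by
    have := congrArg euler h2
    rw [map_add, euler.leibniz_pow, euler.leibniz_pow, euler_yU, euler.leibniz, he,
      ← Nat.cast_ofNat (R := S), euler.map_natCast] at this
    simp only [smul_eq_mul, nsmul_eq_mul, Nat.cast_ofNat] at this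
    refine two_mul_cancel ?_
    linear_combination this
  -- Cross-multiplying `k1` and `k2` avoids inverting `t - b`.
  have k3 : euler (t : S) = a * DDer t := by
    refine ((yU ^ 2).isUnit).mul_left_cancel ?_
    rw [Units.val_pow_eq_pow_val]
    linear_combination (-euler (t : S)) * k1 + thetaY (t : S) * k2 - a * sq_mul_DDer (t : S)
  refine ⟨k3, ?_⟩
  rw [he, hD, k3]
  ring

theorem sub_A_sub_A_mem {t : Sˣ} (h1 : (t : S) - yU ∈ J 1) :
    sub vU t A - A ∈ J 2 := by
  have : A = ↑vU⁻¹ * lin (vU * (1 + yU) ^ 2) := by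
    rw [A_eq, vU_inv, vU_val, yU_val, ← map_one MvPowerSeries.C, ← map_add, ← map_pow, ← map_mul,
      lin_C]
  nth_rw 2 [this]
  rw [sub_A, ← mul_sub]
  refine Ideal.mul_mem_left _ _ (lin_sub_mem_J ?_)
  have : (vU : S) * (1 + t) ^ 2 - vU * (1 + yU) ^ 2 = vU * (2 + t + yU) * (t - yU) := by ring
  rw [this]
  exact Ideal.mul_mem_left _ _ h1

theorem A_mem : A ∈ J 1 := mem_J_one.2 constantCoeff_A

theorem sub_A_mem {t : Sˣ} (h1 : (t : S) - yU ∈ J 1) :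
    sub vU t A ∈ J 1 := by
  have := add_mem (J_mono one_le_two (sub_A_sub_A_mem h1)) A_mem
  rwa [sub_add_cancel] at this

theorem pow_mem_J {f : S} (h : f ∈ J 1) (r : ℕ) : f ^ r ∈ J r := by
  induction r with
  | zero => exact fun m hm => absurd hm (Nat.not_lt_zero _)
  | succ r ih => rw [pow_succ]; exact mul_mem_J ih h

theorem pow_sub_A_mem {t : Sˣ} (h1 : (t : S) - yU ∈ J 1) (r : ℕ) :
    sub vU t A ^ r - A ^ r ∈ J (r + 1) := by
  induction r with
  | zero => simp
  | succ r ih =>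
    have : sub vU t A ^ (r + 1) - A ^ (r + 1) =
        sub vU t A ^ r * (sub vU t A - A) + (sub vU t A ^ r - A ^ r) * A := by ring
    rw [this]
    exact add_mem (mul_mem_J (a := r) (b := 2) (pow_mem_J (sub_A_mem h1) r) (sub_A_sub_A_mem h1))
      (mul_mem_J ih A_mem)

/-- The series `T` in closed form. -/
theorem T_eq {t : Sˣ} (h1 : (t : S) - yU ∈ J 1)
    (h2 : (t : S) ^ 2 = yU ^ 2 + 2 * sub vU t A) :
    T = t + sub vU t A := by
  obtain ⟨ht, ha⟩ := euler_implicit h2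
  set a := sub vU t A with hadef
  -- Chosen so that `DDer b = (1 + t) * DDer t`, whose degree-0 part is the prefactor `(1 + y)/y`.
  set b : S := t + (1 / 2 : ℚ) • (t : S) ^ 2 with hbdef
  have hDb : DDer b = (1 + t) * DDer t := by
    refine two_mul_cancel ?_
    rw [hbdef, map_add, DDer.map_smul, DDer.leibniz_pow, mul_add, two_mul_half_smul]
    simp only [smul_eq_mul, nsmul_eq_mul]
    push_cast
    ring
  have hEb : euler b = a * DDer b := by
    refine two_mul_cancel ?_
    rw [hDb, hbdef, map_add, euler.map_smul, euler.leibniz_pow, mul_add,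
      two_mul_half_smul, ht]
    simp only [smul_eq_mul, nsmul_eq_mul]
    push_cast
    ring
  have hDb' : DDer b - MvPowerSeries.C ((1 + y 1) * y (-1)) ∈ J 1 := by
    have hy : (MvPowerSeries.C ((1 + y 1) * y (-1)) : S) = (1 + yU) * DDer yU := by
      rw [map_mul, map_add, map_one, yU_val, DDer_apply, ← yU_val, thetaY_yU, yU_val, C_y_mul]
      norm_num
    have : DDer b - MvPowerSeries.C ((1 + y 1) * y (-1)) =
        DDer t * ((t : S) - (yU : S)) + (1 + (yU : S)) * DDer ((t : S) - (yU : S)) := by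
      rw [hDb, hy, map_sub]; ring
    rw [this]
    exact add_mem (Ideal.mul_mem_left _ _ h1) (Ideal.mul_mem_left _ _ (DDer_mem_J h1))
  ext1 m
  rcases Nat.eq_zero_or_eq_succ_pred m.degree with hm | hm
  · rw [(Finsupp.degree_eq_zero_iff m).1 hm, MvPowerSeries.coeff_zero_eq_constantCoeff_apply,
      MvPowerSeries.coeff_zero_eq_constantCoeff_apply, constantCoeff_T, map_add,
      mem_J_one.1 (sub_A_mem h1), add_zero]
    have := mem_J_one.1 h1
    rw [map_sub, yU_val, MvPowerSeries.constantCoeff_C, sub_eq_zero] at this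
    exact this.symm
  · set r := m.degree.pred
    have hm0 : m ≠ 0 := by
      rintro rfl
      simp at hm
    have e1 : MvPowerSeries.coeff m T = MvPowerSeries.coeff m (termT r) := by
      classical
      rw [T, map_add, MvPowerSeries.coeff_C, if_neg hm0, zero_add]
      refine finsum_eq_single _ r fun r' hr' => coeff_termT_of_ne fun h => hr' ?_
      omega
    -- In degree `r + 1` only the leading parts count, so `A(v, y)` may be replaced by `A(v, t)` and
    -- `(1 + y)/y` by `DDer b`.
    have e2 : a ^ (r + 1) * DDer b - MvPowerSeries.C ((1 + y 1) * y (-1)) * A ^ (r + 1) ∈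
        J (r + 2) := by
      have : a ^ (r + 1) * DDer b - MvPowerSeries.C ((1 + y 1) * y (-1)) * A ^ (r + 1) =
          a ^ (r + 1) * (DDer b - MvPowerSeries.C ((1 + y 1) * y (-1))) +
          MvPowerSeries.C ((1 + y 1) * y (-1)) * (a ^ (r + 1) - A ^ (r + 1)) := by ring
      rw [this]
      exact add_mem (mul_mem_J (a := r + 1) (b := 1) (pow_mem_J (sub_A_mem h1) _) hDb')
        (Ideal.mul_mem_left _ _ (pow_sub_A_mem h1 _))
    have e3 := DDer_iterate_mem_J e2 r m (by omega)
    rw [DDer_iterate_sub, map_sub, sub_eq_zero, coeff_lagrange ha hEb, hm,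
      Nat.descFactorial_self] at e3
    rw [e1, termT, coeff_qsmul, D_eq, ← e3, smul_smul, one_div, inv_mul_cancel₀, one_smul]
    -- The implicit equation makes `b` and `t + a` differ by `y²/2`, which is invisible in positive
    -- degree.
    · have hb2 : b = t + a + (1 / 2 : ℚ) • (yU : S) ^ 2 := by
        have : (2 : S) * a = (2 : ℚ) • a := by
          rw [Algebra.smul_def, map_ofNat]
        rw [hbdef, h2, this, smul_add, smul_smul]
        norm_num
        ring
      rw [hb2, map_add, coeff_qsmul, yU_val, ← map_pow, MvPowerSeries.coeff_C_of_ne_zero hm0,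
        smul_zero, add_zero]
    · exact_mod_cast (Nat.factorial_pos _).ne'

/-! ### The two branches -/

theorem map_diag (ψ : R →+* R) (f : MvPowerSeries ℕ S) :
    MvPowerSeries.map ψ (diag f) = diag (MvPowerSeries.map (MvPowerSeries.map ψ) f) := by
  ext1 m
  rw [MvPowerSeries.coeff_map, coeff_diag, coeff_diag, map_sum]
  rfl

theorem map_lin (ψ : R →+* R) (u : S) :
    MvPowerSeries.map ψ (lin u) = lin (MvPowerSeries.map ψ u) := by
  rw [lin, map_diag, map_genP, lin]

theorem negY_v (i : ℤ) : negY (v i) = v i := by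
  rw [v, negY, LaurentPolynomial.eval₂_C]

theorem constantCoeff_qsmul (q : ℚ) (f : S) :
    MvPowerSeries.constantCoeff (q • f) = q • MvPowerSeries.constantCoeff f := rfl

theorem exists_branches : ∃ t t' a a' : S,
    MvPowerSeries.constantCoeff t = y 1 ∧ MvPowerSeries.constantCoeff t' = -y 1 ∧
    lin (vU * (1 + t) ^ 2) = vU * a ∧ lin (vU * (1 + t') ^ 2) = vU * a' ∧
    t ^ 2 = yU ^ 2 + 2 * a ∧ t' ^ 2 = yU ^ 2 + 2 * a' ∧ 2 * oddT = t + a - (t' + a') := by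
  obtain ⟨t₀, h1, h2⟩ := exists_implicit
  have ht : MvPowerSeries.constantCoeff t₀ = y 1 := by
    have := mem_J_one.1 h1
    rwa [map_sub, yU_val, MvPowerSeries.constantCoeff_C, sub_eq_zero] at this
  obtain ⟨t, rfl⟩ := isUnit_of_constantCoeff yUnit ht
  have hT := T_eq h1 (by rw [sub_A]; exact h2)
  rw [sub_A] at hT
  generalize ha : (↑vU⁻¹ : S) * lin (vU * (1 + t) ^ 2) = a at h2 hT
  have hl : lin (vU * (1 + t) ^ 2) = vU * a := by rw [← ha, Units.mul_inv_cancel_left]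
  have hτv : MvPowerSeries.map negY (vU : S) = vU := by rw [vU_val, MvPowerSeries.map_C, negY_v]
  have hτy : MvPowerSeries.map negY (yU : S) = -yU := by
    rw [yU_val, MvPowerSeries.map_C, negY_y, map_neg]
  refine ⟨t, MvPowerSeries.map negY (t : S), a, MvPowerSeries.map negY a, ht, ?_, hl, ?_, h2, ?_, ?_⟩
  · rw [MvPowerSeries.constantCoeff_map, ht, negY_y]
  · have := congrArg (MvPowerSeries.map negY) hl
    rwa [map_lin, map_mul, map_mul, hτv, map_pow, map_add, map_one] at this
  · have := congrArg (MvPowerSeries.map negY) h2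
    rw [map_pow, map_add, map_pow, hτy, map_mul, map_ofNat] at this
    rw [this]
    ring
  · rw [oddT, two_mul_half_smul, hT, map_add]

theorem exists_parameters : ∃ w g : Sˣ, ∃ a a' : S,
    MvPowerSeries.constantCoeff (w : S) = 1 ∧ MvPowerSeries.constantCoeff (g : S) = y 1 ∧
    lin (vU * w ^ 2 * (1 + g) ^ 2) = vU * a ∧ lin (vU * w ^ 2 * (1 - g) ^ 2) = vU * a' ∧
    ((w : S) - 1 + w * g) ^ 2 = yU ^ 2 + 2 * a ∧ ((w : S) - 1 - w * g) ^ 2 = yU ^ 2 + 2 * a' ∧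
    oddT = w ^ 2 * g := by
  obtain ⟨t, t', a, a', ht, ht', hl, hl', h2, h2', hT⟩ := exists_branches
  have hwc : MvPowerSeries.constantCoeff (1 + (1 / 2 : ℚ) • (t + t')) = 1 := by
    rw [map_add, map_one, constantCoeff_qsmul, map_add, ht, ht', add_neg_cancel, smul_zero,
      add_zero]
  have hpc : MvPowerSeries.constantCoeff ((1 / 2 : ℚ) • (t - t')) = y 1 := by
    rw [constantCoeff_qsmul, map_sub, ht, ht', sub_neg_eq_add, ← two_smul ℚ, smul_smul]
    norm_num
  obtain ⟨w, hw⟩ := isUnit_of_constantCoeff 1 hwc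
  obtain ⟨p, hp⟩ := isUnit_of_constantCoeff yUnit hpc
  have hw2 : 2 * (w : S) = 2 + (t + t') := by rw [hw, mul_add, two_mul_half_smul, mul_one]
  have hp2 : 2 * (p : S) = t - t' := by rw [hp, two_mul_half_smul]
  rw [← hw] at hwc
  rw [← hp] at hpc
  -- With `w = 1 + (t + t')/2` and `p = (t - t')/2`, this gives `1 + t = w(1 + g)` and `1 + t' = w(1
  -- - g)`.
  obtain ⟨g, rfl⟩ : ∃ g, p = w * g := ⟨w⁻¹ * p, by rw [mul_inv_cancel_left]⟩
  rw [Units.val_mul] at hp2 hpc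
  have e1 : t = w - 1 + w * g := two_mul_cancel (by linear_combination -hw2 - hp2)
  have e2 : t' = w - 1 - w * g := two_mul_cancel (by linear_combination -hw2 + hp2)
  rw [e1] at h2 hl hT
  rw [e2] at h2' hl' hT
  refine ⟨w, g, a, a', hwc, ?_, ?_, ?_, h2, h2', ?_⟩
  · rwa [map_mul, hwc, one_mul] at hpc
  · refine (congrArg lin ?_).trans hl
    ring
  · refine (congrArg lin ?_).trans hl'
    ring
  · exact two_mul_cancel (two_mul_cancel (by linear_combination 2 * hT - h2 + h2'))

/-! ### Jacobians at the origin -/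

theorem constantCoeff_mapDer (d : Derivation ℚ R R) (f : S) :
    MvPowerSeries.constantCoeff (mapDer d f) = d (MvPowerSeries.constantCoeff f) := rfl

theorem constantCoeff_dlog (a b : ℤ) {u : Sˣ} {i j : ℤ}
    (hu : MvPowerSeries.constantCoeff (u : S) = mono 1 i j) :
    MvPowerSeries.constantCoeff (dlog (mapDer (eigenDer a b)) u) = mono (a * i + b * j : ℤ) 0 0 := by
  have h := congrArg MvPowerSeries.constantCoeff (mul_dlog (mapDer (eigenDer a b)) u)
  rw [map_mul, constantCoeff_mapDer, hu, eigenDer_mono] at h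
  have h' := congrArg (mono 1 (-i) (-j) * ·) h
  simp only [← mul_assoc, mono_mul, mul_one, neg_add_cancel, ← one_eq_mono, one_mul] at h'
  exact h'

theorem constantCoeff_jac {k g : Sˣ} {i j i' j' : ℤ}
    (hk : MvPowerSeries.constantCoeff (k : S) = mono 1 i j)
    (hg : MvPowerSeries.constantCoeff (g : S) = mono 1 i' j') :
    ((MvPowerSeries.constantCoeff (jac k g)).coeff 0).coeff 0 = i * j' - j * i' := by
  have : MvPowerSeries.constantCoeff (jac k g) = mono (i * j' - j * i') 0 0 := by
    rw [jac, map_sub, map_mul, map_mul, thetaV, thetaY, constantCoeff_dlog _ _ hk,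
      constantCoeff_dlog _ _ hg, constantCoeff_dlog _ _ hk, constantCoeff_dlog _ _ hg, mono_mul,
      mono_mul, sub_eq_iff_eq_add, add_zero, mono_add]
    congr 1
    push_cast
    ring
  rw [this, coeff_mono, if_pos ⟨rfl, rfl⟩]

/-! ### The undeformed data -/

/-- The series `P(v (1 + ε y) ^ 2)`. -/
def branch (ε : ℚ) : S := genP (v 1 * (1 + mono ε 0 1) ^ 2)

/-- The difference quotient `(Q(U) - Q(V)) / (U - V)`, where `Q = X - 2 P(X)`,
`U = v (1 + y) ^ 2` and `V = v (1 - y) ^ 2`. -/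
def quot : S := 1 - MvPowerSeries.C (mono (1 / 2) (-1) (-1)) * (branch 1 - branch (-1))

/-- The sum `Q(U) + Q(V)`, where `Q = X - 2 P(X)`, `U = v (1 + y) ^ 2` and `V = v (1 - y) ^ 2`. -/
def total : S := MvPowerSeries.C (mono 2 1 0 + mono 2 1 2) - 2 * (branch 1 + branch (-1))

theorem sub_branch (k g : Sˣ) (ε : ℚ) :
    sub k g (branch ε) = lin (k * (1 + algebraMap ℚ S ε * g) ^ 2) := by
  rw [branch, sub_genP, map_mul, phi_v, zpow_one, map_pow, map_add, map_one, phi_mono, zpow_zero,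
    zpow_one, Units.val_one, mul_one]

theorem sub_branch_one (k g : Sˣ) : sub k g (branch 1) = lin (k * (1 + g) ^ 2) := by
  rw [sub_branch, map_one, one_mul]

theorem sub_branch_neg_one (k g : Sˣ) : sub k g (branch (-1)) = lin (k * (1 - g) ^ 2) := by
  have h : 1 + -1 * (g : S) = 1 - g := by ring
  rw [sub_branch, map_neg, map_one, h]

theorem constantCoeff_branch (ε : ℚ) : MvPowerSeries.constantCoeff (branch ε) = 0 :=
  coeff_genP_of_ne (v 1 * (1 + mono ε 0 1) ^ 2) (m := 0) (by simp)

theorem isUnit_quot : IsUnit quot := by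
  refine isUnit_of_constantCoeff 1 ?_
  rw [quot, map_sub, map_mul, map_sub, constantCoeff_branch, constantCoeff_branch]
  simp

/-- Since `U - V = 4kg`, the difference quotient of `2P` has denominator `2kg`; this explains the
constant `1/2` in `quot`. -/
theorem sub_quot (k g : Sˣ) : 2 * (k * g) * sub k g quot =
    2 * (k * g) - (lin (k * (1 + g) ^ 2) - lin (k * (1 - g) ^ 2)) := by
  rw [quot, map_sub, map_mul, map_sub, sub_branch_one, sub_branch_neg_one, sub_C, phi_mono,
    map_one, zpow_neg_one, zpow_neg_one]
  have h2 : 2 * algebraMap ℚ S (1 / 2) = 1 := by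
    rw [← map_ofNat (algebraMap ℚ S) 2, ← map_mul]
    norm_num
  have hk := k.mul_inv
  have hg := g.mul_inv
  generalize algebraMap ℚ S (1 / 2) = c at *
  generalize (↑k⁻¹ : S) = k' at *
  generalize (↑g⁻¹ : S) = g' at *
  generalize lin _ - lin _ = l
  linear_combination (-l * k * k' * g * g') * h2 - l * g * g' * hk - l * hg

theorem sub_total (k g : Sˣ) : sub k g total =
    2 * k * (1 + g ^ 2) - 2 * (lin (k * (1 + g) ^ 2) + lin (k * (1 - g) ^ 2)) := by
  rw [total, map_sub, map_mul, map_add (sub k g), sub_branch_one, sub_branch_neg_one, sub_C, map_add,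
    phi_mono, phi_mono, map_ofNat, map_ofNat, zpow_zero, zpow_one, zpow_ofNat,
    Units.val_pow_eq_pow_val, Units.val_one]
  ring

/-! ### The change of variables -/

/-- The factor in front of `(v y) ^ (-N)` after the change of variables, times `4`. -/
def density (h : Sˣ) : S :=
  thetaY total + 2 * ((↑h⁻¹ : S) * bracket quot total) + 4 * (vU * thetaY quot)

theorem vU_mul_thetaY (f : S) : vU * thetaY f = bracket vU f := by
  rw [bracket, thetaV_vU, thetaY_vU, zero_mul, sub_zero]

theorem thetaY_eq_bracket (f : S) : thetaY f = ↑vU⁻¹ * bracket vU f := by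
  rw [← vU_mul_thetaY, Units.inv_mul_cancel_left]

/-- For `k = v w²`, `d log k + 2 w d(1/w) = d log v`, so the first two terms give `{v, M}/v = 4{v,
w} + 4 v y²`. The last term is `-4{v, w}`. -/
theorem bracket_identity (w : Sˣ) (M : S) (hM : M = vU * (4 * w - 2 + 2 * yU ^ 2)) :
    ↑vU⁻¹ * (↑w⁻¹) ^ 2 * bracket (vU * w ^ 2) M + 2 * (w * bracket (↑w⁻¹) M) +
      4 * bracket (vU * w ^ 2) ↑w⁻¹ = 4 * (vU * yU ^ 2) := by
  have e1 : ∀ δ : Derivation ℚ S S, δ M = δ vU * (4 * w - 2 + 2 * yU ^ 2) +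
      vU * (4 * (w * dlog δ w) + 4 * (yU * δ yU)) := fun δ => by
    have h4 : δ (4 : S) = 0 := by
      rw [← Nat.cast_ofNat (R := S)]; exact δ.map_natCast 4
    have h2 : δ (2 : S) = 0 := by
      rw [← Nat.cast_ofNat (R := S)]; exact δ.map_natCast 2
    rw [hM, δ.leibniz, map_add, map_sub, δ.leibniz, δ.leibniz, δ.leibniz_pow, h4, h2, ← mul_dlog]
    simp only [smul_eq_mul, nsmul_eq_mul]
    push_cast
    ring
  have e2 : ∀ δ : Derivation ℚ S S, δ (vU * w ^ 2) =
      δ vU * w ^ 2 + 2 * vU * (w ^ 2 * dlog δ w) := fun δ => by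
    rw [δ.leibniz, δ.leibniz_pow, ← mul_dlog δ w]
    simp only [smul_eq_mul, nsmul_eq_mul]
    push_cast
    ring
  simp only [bracket, e1, e2, derivation_inv, thetaV_vU, thetaY_vU, thetaV_yU, thetaY_yU]
  have hw := w.mul_inv
  have hv := vU.mul_inv
  generalize dlog thetaV w = α
  generalize dlog thetaY w = β
  generalize (↑w⁻¹ : S) = i at *
  generalize (↑vU⁻¹ : S) = j at *
  generalize (w : S) = x at *
  generalize (vU : S) = u at *
  generalize (yU : S) = z at *
  have hi : i ^ 2 * x ^ 2 = 1 := by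
    rw [← mul_pow, mul_comm, hw, one_pow]
  linear_combination
    (u ^ 2 * j * ((1 + 2 * α) * (4 * x * β + 4 * z ^ 2) -
      2 * β * (4 * x - 2 + 2 * z ^ 2 + 4 * x * α))) * hi +
    (u * ((1 + 2 * α) * (4 * x * β + 4 * z ^ 2) -
      2 * β * (4 * x - 2 + 2 * z ^ 2 + 4 * x * α))) * hv +
    (2 * (β * (u * (4 * x - 2 + 2 * z ^ 2) + 4 * u * x * α) - α * u * (4 * x * β + 4 * z ^ 2)) -
      4 * u * x * β) * hw

theorem units_sq_inv {M : Type*} [CommMonoid M] (u w : Mˣ) : (u * w ^ 2)⁻¹ = u⁻¹ * w⁻¹ ^ 2 := by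
  rw [mul_inv, inv_pow]

theorem units_sq_inv_mul {M : Type*} [CommMonoid M] (u w : Mˣ) :
    (u * w ^ 2)⁻¹ * w = u⁻¹ * w⁻¹ := by
  rw [mul_inv, mul_assoc, sq, mul_inv, inv_mul_cancel_right]

theorem units_sq_zpow_mul {M : Type*} [CommMonoid M] (u w : Mˣ) (n : ℤ) :
    (u * w ^ 2) ^ n * w⁻¹ ^ n = u ^ n * w ^ n := by
  rw [← mul_zpow, ← mul_zpow, sq, mul_assoc, mul_inv_cancel_right]

theorem vU_zpow (n : ℤ) : (↑(vU ^ n) : S) = MvPowerSeries.C (v n) := by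
  induction n using Int.induction_on with
  | zero => rw [zpow_zero, Units.val_one, v_zero, map_one]
  | succ n ih => rw [zpow_add_one, Units.val_mul, ih, vU_val, C_v_mul]
  | pred n ih => rw [zpow_sub_one, Units.val_mul, ih, vU_inv, C_v_mul, sub_eq_add_neg]

theorem yU_zpow (n : ℤ) : (↑(yU ^ n) : S) = MvPowerSeries.C (y n) := by
  induction n using Int.induction_on with
  | zero => rw [zpow_zero, Units.val_one, y_zero, map_one]
  | succ n ih => rw [zpow_add_one, Units.val_mul, ih, yU_val, C_y_mul]
  | pred n ih => rw [zpow_sub_one, Units.val_mul, ih, yU_inv, C_y_mul, sub_eq_add_neg]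

theorem vU_zpow_mul_yU_zpow (i j : ℤ) :
    ((vU ^ i : Sˣ) : S) * ((yU ^ j : Sˣ) : S) = MvPowerSeries.C (mono 1 i j) := by
  rw [vU_zpow, yU_zpow, ← map_mul, v_eq, y_eq, mono_mul]
  norm_num

/-- The substitution sends `quot` to `1/w` and `total` to `v(4w - 2 + 2y²)`, by the difference and
the sum of the branch equations. As brackets transform by the Jacobian, `bracket_identity` applies.
-/
theorem sub_density {w g h : Sˣ} {a a' : S} (hh : (h : S) = quot)
    (hl : lin (vU * w ^ 2 * (1 + g) ^ 2) = vU * a)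
    (hl' : lin (vU * w ^ 2 * (1 - g) ^ 2) = vU * a')
    (ha : ((w : S) - 1 + w * g) ^ 2 = yU ^ 2 + 2 * a)
    (ha' : ((w : S) - 1 - w * g) ^ 2 = yU ^ 2 + 2 * a') :
    sub (vU * w ^ 2) g (density h) * jac (vU * w ^ 2) g = 4 * (vU * yU ^ 2) := by
  set k : Sˣ := vU * w ^ 2 with hk
  have hkv : (k : S) = vU * w ^ 2 := by rw [hk, Units.val_mul, Units.val_pow_eq_pow_val]
  have hM : sub k g total = vU * (4 * w - 2 + 2 * yU ^ 2) := by
    rw [sub_total, hkv, hl, hl']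
    linear_combination (vU : S) * (ha + ha')
  have hq : sub k g quot = ↑w⁻¹ := by
    have := sub_quot k g
    rw [hkv, hl, hl'] at this
    refine two_mul_cancel (two_mul_cancel ((k * g * w).isUnit.mul_left_cancel ?_))
    rw [Units.val_mul, Units.val_mul, hkv]
    have hw := w.mul_inv
    linear_combination 2 * (w : S) * this - 4 * vU * w ^ 2 * g * hw + vU * w * (ha - ha')
  have hq' : sub k g ↑h⁻¹ = w := by
    have := congrArg (sub k g) h.mul_inv
    rw [map_mul, hh, hq, map_one] at this
    rw [← mul_one (w : S), ← this, Units.mul_inv_cancel_left]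
  have hsv : sub k g vU = k := by rw [vU_val, sub_C, phi_v, zpow_one]
  have hsv' : sub k g ↑vU⁻¹ = ↑vU⁻¹ * (↑w⁻¹) ^ 2 := by
    rw [vU_inv, sub_C, phi_v, zpow_neg_one, hk, units_sq_inv, Units.val_mul,
      Units.val_pow_eq_pow_val, vU_inv]
  rw [← bracket_identity w _ hM, density, thetaY_eq_bracket, vU_mul_thetaY, ← hq, ← hkv, ← hsv,
    bracket_sub, bracket_sub, bracket_sub]
  simp only [map_add, map_mul, map_ofNat, hq', hsv', hq]
  ring

theorem constantCoeff_jac_swap : ((MvPowerSeries.constantCoeff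
    (jac (vU * yU ^ 2) yU⁻¹)).coeff 0).coeff 0 = -1 := by
  rw [constantCoeff_jac (i := 1) (j := 2) (i' := 0) (j' := -1)]
  · norm_num
  · rw [Units.val_mul, Units.val_pow_eq_pow_val, vU_val, yU_val, ← map_pow, ← map_mul,
      MvPowerSeries.constantCoeff_C, v_eq, y_eq, sq, mono_mul, mono_mul]
    norm_num
  · rw [yU_inv, MvPowerSeries.constantCoeff_C, y_eq]

/-- The exchange `(v, y) ↦ (v y², 1/y)` fixes `v(1 + y)²`. -/
theorem lin_plus : lin (↑(vU * yU ^ 2) * (1 + ↑yU⁻¹) ^ 2) = branch 1 := by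
  have : (↑(vU * yU ^ 2) * (1 + ↑yU⁻¹) ^ 2 : S) =
      MvPowerSeries.C (v 1 * (1 + mono 1 0 1) ^ 2) := by
    rw [map_mul, map_pow, map_add, map_one, ← y_eq, ← vU_val, ← yU_val, Units.val_mul,
      Units.val_pow_eq_pow_val]
    linear_combination (vU : S) * (2 * yU + yU * ↑yU⁻¹ + 1) * yU.mul_inv
  rw [this, lin_C, branch]

theorem lin_minus : lin (↑(vU * yU ^ 2) * (1 - ↑yU⁻¹) ^ 2) = branch (-1) := by
  have h : mono (-1) 0 1 = -y 1 := by
    rw [y_eq, eq_neg_iff_add_eq_zero, mono_add, neg_add_cancel]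
    simp [mono]
  have : (↑(vU * yU ^ 2) * (1 - ↑yU⁻¹) ^ 2 : S) =
      MvPowerSeries.C (v 1 * (1 + mono (-1) 0 1) ^ 2) := by
    rw [map_mul, map_pow, map_add, map_one, h, map_neg, ← vU_val, ← yU_val, Units.val_mul,
      Units.val_pow_eq_pow_val]
    linear_combination (vU : S) * (-2 * yU + yU * ↑yU⁻¹ + 1) * yU.mul_inv
  rw [this, lin_C, branch]

theorem sub_swap_quot : sub (vU * yU ^ 2) yU⁻¹ quot = quot := by
  rw [quot, map_sub, map_mul, map_sub, sub_branch_one, sub_branch_neg_one, lin_plus, lin_minus,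
    sub_C, map_one]
  congr 2
  rw [phi_mono, mul_assoc, ← Units.val_mul, zpow_neg_one, zpow_neg_one, inv_inv,
    units_sq_inv_mul, Units.val_mul, vU_inv, yU_inv, ← map_mul,
    ← Algebra.smul_def, v_eq, y_eq, mono_mul]
  ext1 m
  classical
  rw [coeff_qsmul, MvPowerSeries.coeff_C, MvPowerSeries.coeff_C]
  split_ifs
  · rw [smul_mono]; norm_num
  · rw [smul_zero]

theorem sub_swap_total : sub (vU * yU ^ 2) yU⁻¹ total = total := by
  rw [sub_total, lin_plus, lin_minus, total]
  congr 1
  have h : mono 2 1 0 + mono 2 1 2 = 2 * (v 1 * (1 + y 1 ^ 2)) := by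
    rw [v_eq, y_eq, sq, mono_mul, one_eq_mono, mul_add, mono_mul, mono_mul, two_mul,
      add_add_add_comm, mono_add, mono_add]
    norm_num
  rw [h, map_mul, map_mul, map_add, map_pow, map_one, map_ofNat, ← vU_val, ← yU_val,
    Units.val_mul, Units.val_pow_eq_pow_val]
  linear_combination (2 * vU * (yU * ↑yU⁻¹ + 1) : S) * yU.mul_inv

/-- The nonlinear contribution vanishes, because it is odd under the exchange of variables. -/
theorem CT_bracket_quot_total (h : Sˣ) (hh : (h : S) = quot) (n : ℤ) :
    CT (MvPowerSeries.C (mono 1 n n) * ((↑h⁻¹ : S) * bracket quot total)) = 0 := by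
  have h1 : sub (vU * yU ^ 2) yU⁻¹ ↑h⁻¹ = ↑h⁻¹ := by
    have := congrArg (sub (vU * yU ^ 2) yU⁻¹) h.mul_inv
    rw [map_mul, hh, sub_swap_quot, map_one, ← hh] at this
    exact (h.isUnit.mul_left_cancel (this.trans h.mul_inv.symm))
  have h2 : sub (vU * yU ^ 2) yU⁻¹ (MvPowerSeries.C (mono 1 n n)) =
      MvPowerSeries.C (mono 1 n n) := by
    rw [sub_C, phi_mono, map_one, one_mul, ← Units.val_mul, units_sq_zpow_mul, Units.val_mul,
      vU_zpow_mul_yU_zpow]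
  have h4 := CT_sub_mul_jac _ _ _ constantCoeff_jac_swap
    (MvPowerSeries.C (mono 1 n n) * ((↑h⁻¹ : S) * bracket quot total))
  rw [map_mul (sub _ _), map_mul (sub _ _), h1, h2, mul_assoc, mul_assoc, ← bracket_sub, sub_swap_quot,
    sub_swap_total, neg_one_smul] at h4
  -- The constant term equals its own negative.
  ext1 m
  have h5 := congrArg (MvPowerSeries.coeff m) h4
  rw [map_neg] at h5
  rw [map_zero]
  linarith

/-! ### Evaluation of the constant term -/

theorem coeff_CT_C_mono_mul (f : S) (i j : ℤ) (m : ℕ →₀ ℕ) :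
    MvPowerSeries.coeff m (CT (MvPowerSeries.C (mono 1 (-i) (-j)) * f)) =
      ((MvPowerSeries.coeff m f).coeff j).coeff i := by
  rw [coeff_CT, MvPowerSeries.coeff_C_mul, mul_comm, coeff_coeff_mul_mono, mul_one, zero_sub,
    zero_sub, neg_neg, neg_neg]

theorem mono_pow (q : ℚ) (i j : ℤ) (n : ℕ) : mono q i j ^ n = mono (q ^ n) (n * i) (n * j) := by
  induction n with
  | zero => simp [one_eq_mono]
  | succ n ih =>
    rw [pow_succ, ih, mono_mul, pow_succ]
    congr 1 <;> push_cast <;> ring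

theorem coeff_one_add_mono_pow (ε : ℚ) (k n : ℕ) (a i : ℤ) :
    ((mono 1 a 0 * (1 + mono ε 0 1) ^ k).coeff n).coeff i =
      if i = a then ε ^ n * k.choose n else 0 := by
  have h1 : mono 1 a 0 * (1 + mono ε 0 1) ^ k =
      ∑ l ∈ Finset.range (k + 1), mono (ε ^ l * k.choose l) a l := by
    rw [add_comm, add_pow, Finset.mul_sum]
    refine Finset.sum_congr rfl fun l _ => ?_
    rw [one_pow, mul_one, mono_pow, ← mul_assoc, mono_mul, ← nsmul_eq_mul', ← Nat.cast_smul_eq_nsmul ℚ,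
      smul_mono]
    congr 1 <;> ring
  rw [h1]
  simp only [AddMonoidAlgebra.coeff_sum, Finsupp.finsetSum_apply, coeff_mono]
  by_cases hi : i = a
  · rw [if_pos hi]
    by_cases hn : n < k + 1
    · rw [Finset.sum_eq_single_of_mem n (Finset.mem_range.2 hn)]
      · rw [if_pos ⟨hi.symm, rfl⟩]
      · rintro l - hl
        rw [if_neg]
        rintro ⟨-, h⟩
        exact hl (by exact_mod_cast h)
    · rw [Nat.choose_eq_zero_of_lt (by omega), Nat.cast_zero, mul_zero]
      refine Finset.sum_eq_zero fun l hl => if_neg ?_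
      rintro ⟨-, h⟩
      rw [Finset.mem_range] at hl
      omega
  · rw [if_neg hi]
    exact Finset.sum_eq_zero fun l _ => if_neg fun h => hi h.1.symm

theorem coeff_branch_single (ε : ℚ) (a n : ℕ) (i : ℤ) :
    ((MvPowerSeries.coeff (Finsupp.single a 1) (branch ε)).coeff n).coeff i =
      if i = a then ε ^ n * (2 * a).choose n else 0 := by
  rw [branch, coeff_genP_single, mul_pow, ← pow_mul, v_eq, mono_pow, one_pow, mul_one, mul_zero,
    coeff_one_add_mono_pow]

theorem coeff_branch_of_ne (ε : ℚ) {m : ℕ →₀ ℕ} (hm : m.degree ≠ 1) :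
    MvPowerSeries.coeff m (branch ε) = 0 := coeff_genP_of_ne _ hm

theorem coeff_two_mul (f : S) (m : ℕ →₀ ℕ) :
    MvPowerSeries.coeff m (2 * f) = 2 * MvPowerSeries.coeff m f := by
  rw [two_mul, two_mul, map_add]

theorem coeff_coeff_two_mul (f : R) (i j : ℤ) :
    ((2 * f).coeff j).coeff i = 2 * (f.coeff j).coeff i := by
  rw [two_mul, two_mul]; rfl

theorem coeff_total (m : ℕ →₀ ℕ) (n : ℤ) :
    ((MvPowerSeries.coeff m total).coeff n).coeff n =
      -2 * (((MvPowerSeries.coeff m (branch 1)).coeff n).coeff n +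
        ((MvPowerSeries.coeff m (branch (-1))).coeff n).coeff n) := by
  classical
  have h : ((MvPowerSeries.coeff m (MvPowerSeries.C (mono 2 1 0 + mono 2 1 2) : S)).coeff n).coeff n
      = 0 := by
    rw [MvPowerSeries.coeff_C]
    split_ifs
    · rw [AddMonoidAlgebra.coeff_add, Finsupp.add_apply, AddMonoidAlgebra.coeff_add,
        Finsupp.add_apply, coeff_mono, coeff_mono, if_neg (by omega), if_neg (by omega), add_zero]
    · rfl
  rw [total, map_sub, coeff_two_mul, AddMonoidAlgebra.coeff_sub, Finsupp.sub_apply,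
    AddMonoidAlgebra.coeff_sub, Finsupp.sub_apply, h, coeff_coeff_two_mul, map_add, zero_sub,
    neg_mul]
  rfl

theorem coeff_quot (m : ℕ →₀ ℕ) (n : ℤ) :
    ((MvPowerSeries.coeff m quot).coeff n).coeff (n - 1) =
      -(1 / 2) * (((MvPowerSeries.coeff m (branch 1)).coeff (n + 1)).coeff n -
        ((MvPowerSeries.coeff m (branch (-1))).coeff (n + 1)).coeff n) := by
  classical
  have h : ((MvPowerSeries.coeff m (1 : S)).coeff n).coeff (n - 1) = 0 := by
    rw [MvPowerSeries.coeff_one]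
    split_ifs
    · rw [one_eq_mono, coeff_mono, if_neg (by omega)]
    · rfl
  rw [quot, map_sub (MvPowerSeries.coeff m), MvPowerSeries.coeff_C_mul, AddMonoidAlgebra.coeff_sub, Finsupp.sub_apply,
    AddMonoidAlgebra.coeff_sub, Finsupp.sub_apply, h, mul_comm, coeff_coeff_mul_mono, map_sub (MvPowerSeries.coeff m),
    sub_neg_eq_add, sub_neg_eq_add, sub_add_cancel, zero_sub, AddMonoidAlgebra.coeff_sub,
    Finsupp.sub_apply, AddMonoidAlgebra.coeff_sub, Finsupp.sub_apply]
  ring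

theorem coeff_thetaY (f : S) (m : ℕ →₀ ℕ) (i j : ℤ) :
    ((MvPowerSeries.coeff m (thetaY f)).coeff j).coeff i =
      j * ((MvPowerSeries.coeff m f).coeff j).coeff i := by
  rw [thetaY, coeff_mapDer, coeff_eigenDer]
  push_cast
  ring

theorem coeff_vU_mul (f : S) (m : ℕ →₀ ℕ) (i j : ℤ) :
    ((MvPowerSeries.coeff m ((vU : S) * f)).coeff j).coeff i =
      ((MvPowerSeries.coeff m f).coeff j).coeff (i - 1) := by
  rw [vU_val, MvPowerSeries.coeff_C_mul, mul_comm, v_eq, coeff_coeff_mul_mono, sub_zero, mul_one]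

theorem coeff_CT_density (h : Sˣ) (hh : (h : S) = quot) (n : ℤ) (m : ℕ →₀ ℕ) :
    MvPowerSeries.coeff m (CT (MvPowerSeries.C (mono 1 (-n) (-n)) * density h)) =
      -2 * n * (((MvPowerSeries.coeff m (branch 1)).coeff n).coeff n +
          ((MvPowerSeries.coeff m (branch (-1))).coeff n).coeff n) +
      -2 * n * (((MvPowerSeries.coeff m (branch 1)).coeff (n + 1)).coeff n -
          ((MvPowerSeries.coeff m (branch (-1))).coeff (n + 1)).coeff n) := by
  have h4 : MvPowerSeries.C (mono 1 (-n) (-n)) * density h =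
      MvPowerSeries.C (mono 1 (-n) (-n)) * thetaY total +
      (2 : ℚ) • (MvPowerSeries.C (mono 1 (-n) (-n)) * ((↑h⁻¹ : S) * bracket quot total)) +
      (4 : ℚ) • (MvPowerSeries.C (mono 1 (-n) (-n)) * ((vU : S) * thetaY quot)) := by
    rw [density, Algebra.smul_def, Algebra.smul_def, map_ofNat, map_ofNat]
    ring
  rw [h4, map_add CT, map_add CT, CT.map_smul, CT.map_smul, CT_bracket_quot_total h hh, smul_zero,
    add_zero, map_add, map_smul, coeff_CT_C_mono_mul, coeff_CT_C_mono_mul, coeff_vU_mul,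
    coeff_thetaY, coeff_thetaY, coeff_total, coeff_quot, smul_eq_mul]
  ring

theorem zpow_mul_zpow_of_mul_eq {M : Type*} [CommMonoid M] {a b c d : Mˣ} (h : a * b = c * d)
    (n : ℤ) : a ^ n * b ^ n = c ^ n * d ^ n := by
  rw [← mul_zpow, h, mul_zpow]

/-! ### Assembly of the identity -/

theorem four_smul_coeffVY (N : ℕ) : ∃ h : Sˣ, (h : S) = quot ∧
    (4 : ℚ) • coeffVY ((N : ℤ) - 1) (-2) ((oddTUnit ^ (-(N : ℤ)) : Sˣ) : S) =
      CT (MvPowerSeries.C (mono 1 (-N) (-N)) * density h) := by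
  obtain ⟨w, g, a, a', hw, hg, hl, hl', ha, ha', hT⟩ := exists_parameters
  obtain ⟨h, hh⟩ := isUnit_quot
  refine ⟨h, hh, ?_⟩
  have hu : vU * w ^ 2 * g = vU * oddTUnit := by
    rw [mul_assoc]
    congr 1
    ext1
    rw [Units.val_mul, Units.val_pow_eq_pow_val]
    exact hT.symm
  have hj : ((MvPowerSeries.constantCoeff (jac (vU * w ^ 2) g)).coeff 0).coeff 0 = 1 := by
    rw [constantCoeff_jac (i := 1) (j := 0) (i' := 0) (j' := 1)]
    · norm_num
    · rw [Units.val_mul, Units.val_pow_eq_pow_val, map_mul, map_pow, hw, one_pow, mul_one, vU_val,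
        MvPowerSeries.constantCoeff_C, v_eq]
    · rw [hg, y_eq]
  have hc := CT_sub_mul_jac _ _ _ hj (MvPowerSeries.C (mono 1 (-N) (-N)) * density h)
  rw [one_smul] at hc
  rw [← hc, map_mul (sub _ _), mul_assoc, sub_density hh hl hl' ha ha', sub_C, phi_mono, map_one,
    one_mul, coeffVY_eq_CT, ← CT.map_smul]
  congr 1
  -- Here `(kg)^(-N) = v^(-N) oddT^(-N)`; the remaining `v y²` supplies the shifts in the exponents
  -- `N - 1` and `-2`.
  have hz := zpow_mul_zpow_of_mul_eq hu (-(N : ℤ))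
  have hm : (MvPowerSeries.C (mono 1 (-((N : ℤ) - 1)) (- -2)) : S) =
      ((vU ^ (-(N : ℤ)) : Sˣ) : S) * (vU * yU ^ 2) := by
    rw [vU_zpow, vU_val, yU_val, ← mul_assoc, C_v_mul, sq, C_y_mul, ← map_mul, v_eq, y_eq, mono_mul]
    congr 2 <;> ring
  rw [← Units.val_mul, hz, hm, Units.val_mul, Algebra.smul_def, map_ofNat]
  ring

theorem mul_choose_eq_factorial_div (N : ℕ) (hN : 0 < N) :
    (N : ℚ) * ((2 * N).choose N + (2 * N).choose (N + 1)) =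
      ((2 * N + 1)! : ℚ) / (((N - 1)! : ℚ) * ((N + 1)! : ℚ)) := by
  obtain ⟨n, rfl⟩ := Nat.exists_eq_succ_of_ne_zero hN.ne'
  have h := Nat.choose_mul_factorial_mul_factorial
    (show n + 1 + 1 ≤ 2 * (n + 1) + 1 by omega)
  rw [show 2 * (n + 1) + 1 - (n + 1 + 1) = n + 1 by omega, Nat.choose_succ_succ,
    Nat.factorial_succ n] at h
  rw [Nat.succ_eq_add_one, Nat.add_sub_cancel, ← h]
  have h1 : ((n ! : ℕ) : ℚ) ≠ 0 := by exact_mod_cast n.factorial_ne_zero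
  have h2 : (((n + 1 + 1)! : ℕ) : ℚ) ≠ 0 := by exact_mod_cast (n + 1 + 1).factorial_ne_zero
  rw [eq_div_iff (mul_ne_zero h1 h2)]
  push_cast
  ring

theorem coeffVY_oddTUnit (N : ℕ) (hN : 0 < N) (hN' : Even N) :
    coeffVY ((N : ℤ) - 1) (-2) ((oddTUnit ^ (-(N : ℤ)) : Sˣ) : S) =
      (-(((2 * N + 1)! : ℚ) / (((N - 1)! : ℚ) * ((N + 1)! : ℚ)))) •
        (MvPowerSeries.X N : MvPowerSeries ℕ ℚ) := by
  classical
  obtain ⟨h, hh, h4⟩ := four_smul_coeffVY N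
  ext1 m
  have hm := congrArg (MvPowerSeries.coeff m) h4
  rw [coeff_CT_density h hh N, map_smul, smul_eq_mul] at hm
  rw [map_smul, smul_eq_mul, MvPowerSeries.coeff_X, ← mul_choose_eq_factorial_div N hN]
  by_cases hd : m.degree = 1
  · obtain ⟨a, rfl⟩ := exists_eq_single hd
    have h1 : ((N : ℤ) + 1) = ((N + 1 : ℕ) : ℤ) := by push_cast; rfl
    rw [h1, coeff_branch_single, coeff_branch_single, coeff_branch_single, coeff_branch_single] at hm
    by_cases ha : N = a
    · subst ha
      -- For even `N` the branches add at `y^N` and, through the minus sign, also at `y^(N+1)`; for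
      -- odd `N` both pairs would cancel.
      rw [if_pos rfl, if_pos rfl, if_pos rfl, if_pos rfl, hN'.neg_one_pow,
        hN'.add_one.neg_one_pow] at hm
      rw [if_pos rfl]
      simp only [one_pow] at hm
      push_cast at hm ⊢
      linarith
    · have ha' : ¬ (N : ℤ) = a := by exact_mod_cast ha
      rw [if_neg ha', if_neg ha', if_neg ha', if_neg ha'] at hm
      rw [if_neg, mul_zero]
      · linarith
      · intro he
        exact ha ((Finsupp.single_left_injective one_ne_zero) he).symm
  · rw [coeff_branch_of_ne _ hd, coeff_branch_of_ne _ hd] at hm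
    rw [if_neg, mul_zero]
    · simp only [AddMonoidAlgebra.coeff_zero, Finsupp.zero_apply] at hm
      linarith
    · rintro rfl
      simp at hd

end CuriousIdentity

end

theorem theorem1 (N : ℕ) (hN : 0 < N) (hN' : Even N) :
    CuriousIdentity.coeffVY ((N : ℤ) - 1) (-2)
        ((CuriousIdentity.oddTUnit ^ (-(N : ℤ)) : CuriousIdentity.Sˣ) : CuriousIdentity.S)
      = (-(((2 * N + 1)! : ℚ) / (((N - 1)! : ℚ) * ((N + 1)! : ℚ)))) •
          (MvPowerSeries.X N : MvPowerSeries ℕ ℚ) ∧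
    ∀ m : ℕ →₀ ℕ, m.degree ≠ 1 →
      MvPowerSeries.coeff m (CuriousIdentity.coeffVY ((N : ℤ) - 1) (-2)
        ((CuriousIdentity.oddTUnit ^ (-(N : ℤ)) : CuriousIdentity.Sˣ) : CuriousIdentity.S)) = 0 := by
  rw [CuriousIdentity.coeffVY_oddTUnit N hN hN']
  refine ⟨rfl, fun m hm => ?_⟩
  classical
  rw [map_smul, MvPowerSeries.coeff_X, if_neg, smul_zero]
  rintro rfl
  simp at hm
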